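/- **Setting.** Let $n\ge 1$, $1\le k\le d$, and let $\mathcal A=(A_1,\dots,A_d)$ be Hermitian positive semidefinite matrices in $\mathbb C^{n\times n}$; write $\langle a,b\rangle=a^\dagger b$. Put $$\mathrm{Opt}(\mathcal A)=\max_{x\in\mathbb C^n,\ \|x\|=1}\Big(\prod_{i=1}^d\langle x,A_ix\rangle\Big)^{1/d}.$$ Let $\mathcal S_k$ be the set of $k$-element subsets of $\{1,\dots,d\}$, and let $\mathrm{OptSOS}_k(\mathcal A)$ be the infimum of $\lambda^{1/k}$ over real $\lambda$ and multipliers $\alpha_I>0$ ($I\in\mathcal S_k$) with $\prod_{I}\alpha_I\ge 1$ such that $$\lambda\|x\|^{2k}-\tbinom dk^{-1}\sum_{I\in\mathcal S_k}\alpha_I\prod_{i\in I}\langle x,A_ix\rangle$$ is a sum of squares of real polynomials in the $2n$ real variables $\operatorname{Re}x_j,\operatorname{Im}x_j$. A degree-$k$ homogeneous pseudoexpectation is a real-linear functional $\tilde{\mathbb E}$ on real forms of degree $2k$ in these variables with $\tilde{\mathbb E}[\|x\|^{2k}]=1$ and $\tilde{\mathbb E}[f^2]\ge0$ for all forms $f$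 of degree $k$. It is an optimal solution of the dual relaxation if it maximizes $\big(\prod_{I\in\mathcal S_k}\tilde{\mathbb E}[\prod_{i\in I}\langle x,A_ix\rangle]\big)^{1/(d\binom{d-1}{k-1})}$ among all degree-$k$ homogeneous pseudoexpectations. For a unit vector $v\in\mathbb C^n$ let $M(v)=\tilde{\mathbb E}\big[|\langle v,x\rangle|^{2k-2}xx^\dagger\big]$. The rounding procedure with vector $v$ samples $x\sim\mathcal N_{\mathbb C}(0,M(v))$ (circularly symmetric complex Gaussian with covariance $M(v)$) and returns $y=x/\|x\|$. **Constants.** Let $\gamma$ be the Euler–Mascheroni constant, $\psi(x)=\frac{d}{dx}\log\Gamma(x)$, $L_n(\mathbb C)=\gamma+\psi(n)-\log n$, and $1-\epsilon=\frac{k}{k+n-1}$. For $n,k\ge2$ let $$C(n,k)=\gamma+\frac{(1-\epsilon)^{n-1}(-\gamma+\log(1-\epsilon))}{(1-\epsilon-\frac{\epsilon}{n-1})^{n-1}}-\sum_{\ell=1}^{n-1}\frac{\epsilon(1-\epsilon)^{\ell-1}\big(\log\frac{\epsilon}{n-1}+\psi(n-\ell)\big)}{(n-1)(1-\epsilon-\frac{\epsilon}{n-1})^{\ell}}.$$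 For $k=1$, where this expression is of the form $0/0$, let $C(n,1)=L_n(\mathbb C)$, its limiting value as $\epsilon\to\frac{n-1}{n}$; and let $C(1,k)=0$. **Theorem.** (a) Suppose $\mathrm{OptSOS}_k(\mathcal A)=\mathrm{Opt}(\mathcal A)$, and let $\tilde{\mathbb E}$ be any optimal solution of the dual relaxation that is an actual expectation over solutions: there is a probability measure $\mu$ on the set of maximizers of $\mathrm{Opt}(\mathcal A)$ on the unit sphere with $\tilde{\mathbb E}[f]=\int f\,d\mu$ for all real forms $f$ of degree $2k$. Then there is a unit vector $v\in\mathbb C^n$ such that $M(v)$ is a nonzero positive semidefinite matrix and the output $y$ of the rounding procedure with vector $v$ satisfies $$\mathbb E_y\Big[\prod_{i=1}^d\langle y,A_iy\rangle^{1/d}\Big]\ \ge\ e^{-C(n,k)}\,\mathrm{OptSOS}_k(\mathcal A).$$ (b) $0\le C(n,k)\le L_n(\mathbb C)$ for all $n,k\ge1$, and $C(n,k)$ is non-increasing in $k\ge1$, strictly decreasing if $n\ge2$. -/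

import Mathlib

open MeasureTheory ProbabilityTheory
open scoped Matrix MatrixOrder ComplexOrder

namespace PSDForms

noncomputable section

/-! ### Products of PSD forms on the complex sphere -/

/-- Points of `ℂⁿ` with the Hermitian norm `‖x‖² = ∑ |x_j|²`. -/
abbrev Vec (n : ℕ) : Type := EuclideanSpace ℂ (Fin n)

/-- The value `⟨x, A x⟩ = x† A x`, a real number when `A` is Hermitian. -/
def quadForm {n : ℕ} (A : Matrix (Fin n) (Fin n) ℂ) (x : Vec n) : ℝ :=
  (star x.ofLp ⬝ᵥ (A *ᵥ x.ofLp)).re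

/-- The geometric mean `(∏ᵢ ⟨x, Aᵢ x⟩)^(1/d)`. -/
def geomMean {n d : ℕ} (A : Fin d → Matrix (Fin n) (Fin n) ℂ) (x : Vec n) : ℝ :=
  (∏ i, quadForm (A i) x) ^ ((1 : ℝ) / d)

/-- `Opt(A)`: the maximum of the geometric mean over the unit sphere of `ℂⁿ`. -/
def opt {n d : ℕ} (A : Fin d → Matrix (Fin n) (Fin n) ℂ) : ℝ :=
  sSup (geomMean A '' {x : Vec n | ‖x‖ = 1})

/-! ### Real polynomials in the real and imaginary parts of `x ∈ ℂⁿ` -/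

/-- Real polynomials in the `2n` variables `Re x_j` (index `inl j`) and `Im x_j` (index `inr j`). -/
abbrev RealPoly (n : ℕ) : Type := MvPolynomial (Fin n ⊕ Fin n) ℝ

/-- The real coordinates `(Re x_j, Im x_j)` of a point `x ∈ ℂⁿ`. -/
def realCoords {n : ℕ} (x : Vec n) : Fin n ⊕ Fin n → ℝ :=
  Sum.elim (fun j => (x j).re) (fun j => (x j).im)

/-- The polynomial `Re (x_a conj(x_b))`. -/
def rePoly {n : ℕ} (a b : Fin n) : RealPoly n :=
  MvPolynomial.X (Sum.inl a) * MvPolynomial.X (Sum.inl b)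
    + MvPolynomial.X (Sum.inr a) * MvPolynomial.X (Sum.inr b)

/-- The polynomial `Im (x_a conj(x_b))`. -/
def imPoly {n : ℕ} (a b : Fin n) : RealPoly n :=
  MvPolynomial.X (Sum.inr a) * MvPolynomial.X (Sum.inl b)
    - MvPolynomial.X (Sum.inl a) * MvPolynomial.X (Sum.inr b)

/-- The polynomial `Re ⟨x, A x⟩ = Re ∑_{a,b} A_{ab} conj(x_a) x_b`; this is `⟨x, A x⟩` for
Hermitian `A`. -/
def quadPoly {n : ℕ} (A : Matrix (Fin n) (Fin n) ℂ) : RealPoly n :=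
  ∑ a, ∑ b, (MvPolynomial.C (A a b).re * rePoly b a - MvPolynomial.C (A a b).im * imPoly b a)

/-- The polynomial `‖x‖²`. -/
def normSqPoly (n : ℕ) : RealPoly n := ∑ j, rePoly j j

/-- The polynomial `|⟨v, x⟩|² = ⟨x, v v† x⟩`. -/
def overlapPoly {n : ℕ} (v : Vec n) : RealPoly n :=
  quadPoly (Matrix.vecMulVec v.ofLp (star v.ofLp))

theorem eval_rePoly {n : ℕ} (a b : Fin n) (x : Vec n) :
    MvPolynomial.eval (realCoords x) (rePoly a b) = (x a * star (x b)).re := by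
  simp [rePoly, realCoords]

theorem eval_imPoly {n : ℕ} (a b : Fin n) (x : Vec n) :
    MvPolynomial.eval (realCoords x) (imPoly a b) = (x a * star (x b)).im := by
  simp [imPoly, realCoords]; ring

theorem eval_quadPoly {n : ℕ} (A : Matrix (Fin n) (Fin n) ℂ) (x : Vec n) :
    MvPolynomial.eval (realCoords x) (quadPoly A) = quadForm A x := by
  simp only [quadPoly, quadForm, map_sum, map_sub, map_mul, MvPolynomial.eval_C, eval_rePoly,
    eval_imPoly, dotProduct, Matrix.mulVec, Complex.re_sum, Finset.mul_sum, ← Complex.mul_re]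
  refine Finset.sum_congr rfl fun a _ => Finset.sum_congr rfl fun b _ => ?_
  congr 1
  simp only [Pi.star_apply]
  ring

theorem eval_normSqPoly {n : ℕ} (x : Vec n) :
    MvPolynomial.eval (realCoords x) (normSqPoly n) = ‖x‖ ^ 2 := by
  simp only [normSqPoly, map_sum, eval_rePoly, EuclideanSpace.norm_sq_eq]
  refine Finset.sum_congr rfl fun a _ => ?_
  simp [← Complex.normSq_eq_norm_sq, Complex.normSq_apply]

theorem eval_overlapPoly {n : ℕ} (v x : Vec n) :
    MvPolynomial.eval (realCoords x) (overlapPoly v) = ‖inner ℂ v x‖ ^ 2 := by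
  rw [overlapPoly, eval_quadPoly, quadForm, Matrix.vecMulVec_mulVec, EuclideanSpace.inner_eq_star_dotProduct,
    ← Complex.normSq_eq_norm_sq]
  have h : star x.ofLp ⬝ᵥ v.ofLp = star (star v.ofLp ⬝ᵥ x.ofLp) := by
    simp [dotProduct, mul_comm]
  simp [dotProduct_smul, h, dotProduct_comm x.ofLp, Complex.normSq_apply]

/-! ### The sum-of-squares relaxation of level `k` and its dual -/

/-- The index sets `I ⊆ {1, …, d}` with `|I| = k`. -/
def levelSets (d k : ℕ) : Finset (Finset (Fin d)) := Finset.powersetCard k Finset.univ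

/-- `OptSOS_k(A)`: the infimum of `λ^(1/k)` over all `λ` and all multipliers `α_I > 0` with
`∏ α_I ≥ 1` such that `λ ‖x‖^(2k) - (d choose k)⁻¹ ∑_I α_I ∏_{i ∈ I} ⟨x, Aᵢ x⟩` is a sum of
squares of real polynomials. -/
def optSOS {n d : ℕ} (k : ℕ) (A : Fin d → Matrix (Fin n) (Fin n) ℂ) : ℝ :=
  sInf {t : ℝ | ∃ (lam : ℝ) (α : Finset (Fin d) → ℝ),
    (∀ I ∈ levelSets d k, 0 < α I) ∧
    1 ≤ ∏ I ∈ levelSets d k, α I ∧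
    IsSumSq (MvPolynomial.C lam * normSqPoly n ^ k
      - MvPolynomial.C ((d.choose k : ℝ)⁻¹) *
          ∑ I ∈ levelSets d k, MvPolynomial.C (α I) * ∏ i ∈ I, quadPoly (A i)) ∧
    t = lam ^ ((1 : ℝ) / k)}

/-- Degree-`k` homogeneous pseudoexpectation. Only the values of `L` on homogeneous polynomials
of degree `2k` matter; a linear functional on that subspace always extends. -/
def IsPseudoExpectation {n : ℕ} (k : ℕ) (L : RealPoly n →ₗ[ℝ] ℝ) : Prop :=
  L (normSqPoly n ^ k) = 1 ∧ ∀ f : RealPoly n, f.IsHomogeneous k → 0 ≤ L (f ^ 2)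

/-- The objective of the dual of the level-`k` relaxation. -/
def dualValue {n d : ℕ} (k : ℕ) (A : Fin d → Matrix (Fin n) (Fin n) ℂ)
    (L : RealPoly n →ₗ[ℝ] ℝ) : ℝ :=
  (∏ I ∈ levelSets d k, L (∏ i ∈ I, quadPoly (A i))) ^
    ((1 : ℝ) / ((d : ℝ) * ((d - 1).choose (k - 1) : ℝ)))

/-- `L` is an optimal solution of the dual of the level-`k` relaxation. -/
def IsOptimalPseudoExpectation {n d : ℕ} (k : ℕ) (A : Fin d → Matrix (Fin n) (Fin n) ℂ)
    (L : RealPoly n →ₗ[ℝ] ℝ) : Prop :=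
  IsPseudoExpectation k L ∧
    ∀ L' : RealPoly n →ₗ[ℝ] ℝ, IsPseudoExpectation k L' → dualValue k A L' ≤ dualValue k A L

/-- On forms of degree `2k`, `L` is the expectation under an actual probability distribution `μ`
on the set of optimal solutions of `max_{‖x‖ = 1} (∏ᵢ ⟨x, Aᵢ x⟩)^(1/d)`. -/
def IsExpectationOverSolutions {n d : ℕ} (k : ℕ) (A : Fin d → Matrix (Fin n) (Fin n) ℂ)
    (L : RealPoly n →ₗ[ℝ] ℝ) : Prop :=
  ∃ μ : Measure (Vec n), IsProbabilityMeasure μ ∧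
    (∀ᵐ x ∂μ, ‖x‖ = 1 ∧ geomMean A x = opt A) ∧
    ∀ f : RealPoly n, f.IsHomogeneous (2 * k) →
      L f = ∫ x, MvPolynomial.eval (realCoords x) f ∂μ

/-! ### The rounding procedure -/

/-- The matrix `M(v) = L[|⟨v, x⟩|^(2k-2) x x†]`. -/
def momentMatrix {n : ℕ} (k : ℕ) (L : RealPoly n →ₗ[ℝ] ℝ) (v : Vec n) :
    Matrix (Fin n) (Fin n) ℂ :=
  fun a b => ⟨L (overlapPoly v ^ (k - 1) * rePoly a b), L (overlapPoly v ^ (k - 1) * imPoly a b)⟩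

/-- The law of `(y + i z) / √2` with `y`, `z` independent standard real Gaussians. -/
def stdComplexGaussian : Measure ℂ :=
  ((gaussianReal 0 1).prod (gaussianReal 0 1)).map
    (fun p : ℝ × ℝ => ((p.1 : ℂ) + Complex.I * (p.2 : ℂ)) / ((Real.sqrt 2 : ℝ) : ℂ))

/-- The circularly symmetric complex Gaussian law `N_ℂ(0, M)` for positive semidefinite `M`:
the law of `M^{1/2} w`, where `w` has i.i.d. standard complex Gaussian entries. -/
def complexGaussian {n : ℕ} (M : Matrix (Fin n) (Fin n) ℂ) : Measure (Vec n) :=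
  (Measure.pi (fun _ : Fin n => stdComplexGaussian)).map
    (fun w => WithLp.toLp 2 (CFC.sqrt M *ᵥ w))

/-- The law of the output `y = x / ‖x‖` of the rounding, where `x ∼ N_ℂ(0, M(v))`. -/
def roundingLaw {n : ℕ} (k : ℕ) (L : RealPoly n →ₗ[ℝ] ℝ) (v : Vec n) : Measure (Vec n) :=
  (complexGaussian (momentMatrix k L v)).map (fun x => ((‖x‖⁻¹ : ℝ) : ℂ) • x)

/-! ### The constants -/

/-- The digamma function `ψ(x) = d/dx log Γ(x)`. -/
def digamma (x : ℝ) : ℝ := deriv (fun t => Real.log (Real.Gamma t)) x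

/-- `L_r(ℂ) = γ + ψ(r) - log r`. -/
def Lconst (r : ℕ) : ℝ := Real.eulerMascheroniConstant + digamma r - Real.log r

/-- The expression defining `C(n, k)`, as a function of `n` and `ε`. -/
def Cexpr (n : ℕ) (ε : ℝ) : ℝ :=
  Real.eulerMascheroniConstant
    + (1 - ε) ^ (n - 1) * (-Real.eulerMascheroniConstant + Real.log (1 - ε))
        / (1 - ε - ε / ((n : ℝ) - 1)) ^ (n - 1)
    - ∑ l ∈ Finset.Icc 1 (n - 1),
        ε * (1 - ε) ^ (l - 1) * (Real.log (ε / ((n : ℝ) - 1)) + digamma ((n : ℝ) - (l : ℝ)))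
          / (((n : ℝ) - 1) * (1 - ε - ε / ((n : ℝ) - 1)) ^ l)

/-- `C(n, k)`, with `1 - ε = k / (k + n - 1)`. For `k = 1` the expression is of the form `0 / 0`
(all the denominators vanish), and its limiting value is `L_n(ℂ)`. -/
def Cconst (n k : ℕ) : ℝ :=
  if k = 1 then Lconst n else Cexpr n (1 - (k : ℝ) / ((k : ℝ) + (n : ℝ) - 1))

end

end PSDForms

/-!
The constant `C(n, k)` is `γ` plus the mean of `log (a E₁ + b (E₂ + ⋯ + E_n))` for independent unit
exponentials `E_j`, with `a = k / (k + n - 1)` and `b = 1 / (k + n - 1)`. By Frullani's integral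
`log z = ∫₀^∞ (e^{-t} - e^{-tz}) / t dt`, such a mean depends only on a Laplace transform: for weights
`l_j ≥ 0` and a standard complex Gaussian vector `w`, the mean of `log ∑ l_j |w_j|²` is
`∫₀^∞ (e^{-t} - ∏ (1 + t l_j)⁻¹) / t dt` (`integrableOn_and_integral_log_weightedNormSq`). Every
comparison of mean logarithms is thereby a pointwise comparison of products `∏ (1 + t l_j)`, which
follows from `z ≤ e^{z - 1}` (`prod_le_prod_of_sum_div_le`). Partial fractions in the Laplace
transform give the closed form of `C(n, k)` (`Cconst_eq`). Increasing `k` makes the weights more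
unequal, hence the product and the constant smaller.

For the rounding, let `M = M(v)` and `x = √M w`. Unitary invariance of the Gaussian law diagonalises
quadratic forms of `w`. Then `𝔼 log ⟨x, A x⟩ ≥ log tr (A M) - γ`
(`log_trace_sub_le_integral_log_quadForm`), and if the largest eigenvalue of `M` is at least
`k / (k + n - 1) · tr M`, then `𝔼 log ‖x‖² ≤ log tr M + C(n, k) - γ` (`integral_log_quadForm_le`).
Jensen's inequality for the exponential function turns this into a bound for the expected geometric
mean (`exp_mul_le_integral_rounding`).

The vector `v` is a maximiser of `∫ |⟨v, x⟩|^{2k} dμ(x)` on the unit sphere. The second-order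
optimality condition bounds `⟨u, M u⟩` by `⟨v, M v⟩ / k` for unit vectors `u` orthogonal to `v`, so
`tr M ≤ (1 + (n - 1) / k) ⟨v, M v⟩`, which is the eigenvalue condition (`exists_direction`). Finally
`tr (Aᵢ M) / tr M` is the mean of `⟨x, Aᵢ x⟩` over optimal solutions `x` weighted by
`|⟨v, x⟩|^{2k-2}`, and Jensen's inequality for the logarithm shows that the geometric mean of these
numbers over `i` is at least the optimum (`mul_log_opt_le`).
-/

namespace PSDForms

open Set Filter Topology

/-! ### Logarithms as Frullani integrals -/

lemma abs_frullani_le {z t : ℝ} (ht : 0 < t) :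
    |(Real.exp (-t) - Real.exp (-(t * z))) / t| ≤ |z - 1| * Real.exp (-(min 1 z * t)) := by
  -- `e^{-x} - e^{-y} ≤ (y - x) e^{-x}` for all `x`, `y`
  have key : ∀ x y : ℝ, Real.exp (-x) - Real.exp (-y) ≤ (y - x) * Real.exp (-x) := by
    intro x y
    have h := Real.add_one_le_exp (x - y)
    have h2 : Real.exp (-y) = Real.exp (x - y) * Real.exp (-x) := by
      rw [← Real.exp_add]; ring_nf
    nlinarith [Real.exp_pos (-x)]
  rw [abs_div, abs_of_pos ht, div_le_iff₀ ht]
  rcases le_total 1 z with h | h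
  · have h0 : 0 ≤ Real.exp (-t) - Real.exp (-(t * z)) := by
      rw [sub_nonneg, Real.exp_le_exp]; nlinarith
    rw [min_eq_left h, abs_of_nonneg h0, abs_of_nonneg (sub_nonneg.2 h), one_mul]
    exact (key _ _).trans (le_of_eq (by ring))
  · have h0 : Real.exp (-t) - Real.exp (-(t * z)) ≤ 0 := by
      rw [sub_nonpos, Real.exp_le_exp]; nlinarith
    rw [min_eq_right h, abs_of_nonpos h0, abs_of_nonpos (sub_nonpos.2 h), neg_sub]
    exact (key _ _).trans (le_of_eq (by ring_nf))

lemma integrableOn_frullani {z : ℝ} (hz : 0 < z) :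
    IntegrableOn (fun t => (Real.exp (-t) - Real.exp (-(t * z))) / t) (Ioi 0) := by
  refine Integrable.mono'
    ((exp_neg_integrableOn_Ioi 0 (lt_min one_pos hz)).const_mul |z - 1|) ?_ ?_
  · exact Measurable.aestronglyMeasurable (by fun_prop)
  · filter_upwards [ae_restrict_mem measurableSet_Ioi] with t ht
    rw [Real.norm_eq_abs, neg_mul]
    exact abs_frullani_le ht

lemma integral_frullani {z : ℝ} (hz : 0 < z) :
    ∫ t in Ioi 0, (Real.exp (-t) - Real.exp (-(t * z))) / t = Real.log z := by
  have h := Frullani.integral_Ioi_eq (f := fun x : ℝ => Real.exp (-x)) (L := 1) (R := 0)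
    ((show Continuous fun x : ℝ => Real.exp (-x) by fun_prop).locallyIntegrable.locallyIntegrableOn
      _) one_pos hz ?_ ?_ ?_
  · simpa [div_eq_inv_mul, mul_comm z] using h
  · refine tendsto_nhdsWithin_of_tendsto_nhds ?_
    simpa using (show Continuous fun x : ℝ => Real.exp (-x) by fun_prop).tendsto 0
  · exact Real.tendsto_exp_neg_atTop_nhds_zero
  · simpa [div_eq_inv_mul, mul_comm z] using integrableOn_frullani hz

lemma integral_norm_frullani {z : ℝ} (hz : 0 < z) :
    ∫ t in Ioi 0, ‖(Real.exp (-t) - Real.exp (-(t * z))) / t‖ = |Real.log z| := by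
  rcases le_total 1 z with h | h
  · rw [abs_of_nonneg (Real.log_nonneg h), ← integral_frullani hz]
    refine setIntegral_congr_fun measurableSet_Ioi fun t (ht : 0 < t) => ?_
    refine Real.norm_of_nonneg (div_nonneg ?_ ht.le)
    rw [sub_nonneg, Real.exp_le_exp]; nlinarith
  · rw [abs_of_nonpos (Real.log_nonpos hz.le h), ← integral_frullani hz, ← integral_neg]
    refine setIntegral_congr_fun measurableSet_Ioi fun t (ht : 0 < t) => ?_
    refine Real.norm_of_nonpos (div_nonpos_of_nonpos_of_nonneg ?_ ht.le)
    rw [sub_nonpos, Real.exp_le_exp]; nlinarith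

/-- The Frullani integrand stays integrable after averaging over a random `z = Z(ω)`, and its
integral is the mean of `log Z`. This reduces the mean of `log Z` to the Laplace transform
`t ↦ 𝔼 e^{-tZ}`. -/
lemma integrableOn_and_integral_laplace {Ω : Type*} [MeasurableSpace Ω] {P : Measure Ω}
    [IsProbabilityMeasure P] {Z : Ω → ℝ} (hZ : Measurable Z) (hpos : ∀ᵐ w ∂P, 0 < Z w)
    (hlog : Integrable (fun w => Real.log (Z w)) P) :
    IntegrableOn (fun t => (Real.exp (-t) - ∫ w, Real.exp (-(t * Z w)) ∂P) / t) (Ioi 0) ∧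
    ∫ t in Ioi 0, (Real.exp (-t) - ∫ w, Real.exp (-(t * Z w)) ∂P) / t
      = ∫ w, Real.log (Z w) ∂P := by
  have hF : Integrable (fun p : Ω × ℝ => (Real.exp (-p.2) - Real.exp (-(p.2 * Z p.1))) / p.2)
      (P.prod (volume.restrict (Ioi 0))) := by
    rw [integrable_prod_iff (Measurable.aestronglyMeasurable (by fun_prop))]
    refine ⟨hpos.mono fun w hw => integrableOn_frullani hw, ?_⟩
    exact hlog.abs.congr (hpos.mono fun w hw => (integral_norm_frullani hw).symm)
  have hinner : ∀ t ∈ Ioi (0 : ℝ),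
      ∫ w, (Real.exp (-t) - Real.exp (-(t * Z w))) / t ∂P
        = (Real.exp (-t) - ∫ w, Real.exp (-(t * Z w)) ∂P) / t := by
    intro t (ht : 0 < t)
    rw [integral_div, integral_sub (integrable_const _), integral_const]
    · simp
    · refine Integrable.mono' (integrable_const (1 : ℝ))
        (Measurable.aestronglyMeasurable (by fun_prop)) (hpos.mono fun w hw => ?_)
      rw [Real.norm_of_nonneg (Real.exp_pos _).le, Real.exp_le_one_iff]
      nlinarith [mul_pos ht hw]
  constructor
  · exact hF.integral_prod_right.congr
      ((ae_restrict_mem measurableSet_Ioi).mono fun t ht => hinner t ht)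
  · rw [← setIntegral_congr_fun measurableSet_Ioi hinner, ← integral_integral_swap hF]
    exact integral_congr_ae (hpos.mono fun w hw => integral_frullani hw)

/-! ### The standard complex Gaussian law -/

lemma measurable_stdComplexGaussian_map : Measurable
    (fun p : ℝ × ℝ => ((p.1 : ℂ) + Complex.I * (p.2 : ℂ)) / ((Real.sqrt 2 : ℝ) : ℂ)) := by
  fun_prop

instance : IsProbabilityMeasure stdComplexGaussian :=
  Measure.isProbabilityMeasure_map measurable_stdComplexGaussian_map.aemeasurable

/-- The squared modulus of a standard complex Gaussian variable is exponential of rate one. -/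
lemma map_normSq_stdComplexGaussian : stdComplexGaussian.map Complex.normSq
    = (volume.restrict (Ioi 0)).withDensity (fun r : ℝ => ENNReal.ofReal (Real.exp (-r))) := by
  have hm : Measurable Complex.normSq := Complex.continuous_normSq.measurable
  refine Measure.ext_of_lintegral _ fun f hf => ?_
  have himg : (fun r : ℝ => r ^ 2 / 2) '' Ioi 0 = Ioi 0 := by
    ext x
    constructor
    · rintro ⟨r, hr, rfl⟩
      have : (0 : ℝ) < r := hr
      exact mem_Ioi.2 (by positivity)
    · intro (hx : 0 < x)
      refine ⟨Real.sqrt (2 * x), mem_Ioi.2 (by positivity), ?_⟩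
      simp only
      rw [Real.sq_sqrt (by positivity)]; ring
  have hpdf : ∀ r θ : ℝ, gaussianPDF 0 1 (r * Real.cos θ) * gaussianPDF 0 1 (r * Real.sin θ)
      = ENNReal.ofReal ((2 * Real.pi)⁻¹ * Real.exp (-(r ^ 2 / 2))) := by
    intro r θ
    rw [gaussianPDF, gaussianPDF, ← ENNReal.ofReal_mul (gaussianPDFReal_nonneg _ _ _)]
    congr 1
    simp only [gaussianPDFReal, NNReal.coe_one, mul_one, sub_zero]
    rw [mul_mul_mul_comm, ← Real.exp_add, ← mul_inv, Real.mul_self_sqrt (by positivity)]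
    congr 2
    linear_combination -(r ^ 2 / 2) * Real.sin_sq_add_cos_sq θ
  have hns : ∀ p : ℝ × ℝ,
      Complex.normSq (((p.1 : ℂ) + Complex.I * (p.2 : ℂ)) / ((Real.sqrt 2 : ℝ) : ℂ))
        = (p.1 ^ 2 + p.2 ^ 2) / 2 := by
    intro p
    rw [Complex.normSq_div, Complex.normSq_ofReal, Real.mul_self_sqrt (by norm_num)]
    simp [Complex.normSq_apply]; ring
  have hpm : Measurable (gaussianPDF 0 1) := measurable_gaussianPDF 0 1
  rw [lintegral_map hf hm, stdComplexGaussian,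
    lintegral_map (show Measurable fun w => f (Complex.normSq w) from hf.comp hm)
      measurable_stdComplexGaussian_map]
  simp only [hns]
  rw [gaussianReal_of_var_ne_zero _ one_ne_zero, prod_withDensity hpm hpm,
    lintegral_withDensity_eq_lintegral_mul _ (by fun_prop) (by fun_prop),
    ← Measure.volume_eq_prod, ← lintegral_comp_polarCoord_symm]
  rw [lintegral_withDensity_eq_lintegral_mul _ (by fun_prop) hf]
  nth_rw 1 [← himg]
  rw [lintegral_image_eq_lintegral_abs_deriv_mul measurableSet_Ioi (f' := fun r => r)
    (fun x _ => by
      have := ((hasDerivAt_pow 2 x).div_const 2).hasDerivWithinAt (s := Ioi 0)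
      simpa using this)
    (fun x hx y hy h => by
      have hx' : (0 : ℝ) < x := hx
      have hy' : (0 : ℝ) < y := hy
      have h' : x ^ 2 = y ^ 2 := by simpa using h
      exact (pow_left_inj₀ hx'.le hy'.le two_ne_zero).1 h')]
  calc _ = ∫⁻ p in Ioi (0 : ℝ) ×ˢ Ioo (-Real.pi) Real.pi, ENNReal.ofReal p.1 *
        (ENNReal.ofReal ((2 * Real.pi)⁻¹ * Real.exp (-(p.1 ^ 2 / 2))) * f (p.1 ^ 2 / 2)) := by
        refine setLIntegral_congr_fun (measurableSet_Ioi.prod measurableSet_Ioo) fun p _ => ?_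
        simp only [polarCoord_symm_apply, Pi.mul_apply, smul_eq_mul, hpdf]
        congr 3
        linear_combination (p.1 ^ 2 / 2) * Real.sin_sq_add_cos_sq p.2
    _ = ∫⁻ r in Ioi (0 : ℝ), ENNReal.ofReal r *
        (ENNReal.ofReal ((2 * Real.pi)⁻¹ * Real.exp (-(r ^ 2 / 2))) * f (r ^ 2 / 2))
          * ENNReal.ofReal (2 * Real.pi) := by
        rw [Measure.volume_eq_prod, ← Measure.prod_restrict, lintegral_prod _ (by fun_prop)]
        simp only [lintegral_const, Measure.restrict_apply_univ, Real.volume_Ioo, sub_neg_eq_add,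
          two_mul]
    _ = _ := by
        refine setLIntegral_congr_fun measurableSet_Ioi fun r (hr : 0 < r) => ?_
        simp only [Pi.mul_apply]
        rw [abs_of_pos hr, ENNReal.ofReal_mul (by positivity : 0 ≤ (2 * Real.pi)⁻¹)]
        have : ENNReal.ofReal (2 * Real.pi)⁻¹ * ENNReal.ofReal (2 * Real.pi) = 1 := by
          rw [← ENNReal.ofReal_mul (by positivity), inv_mul_cancel₀ (by positivity),
            ENNReal.ofReal_one]
        rw [mul_assoc, mul_right_comm _ (f _), mul_right_comm _ (ENNReal.ofReal (Real.exp _)), this,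
          one_mul]

lemma integrable_comp_normSq_iff {g : ℝ → ℝ} (hg : Measurable g) :
    Integrable (fun w => g (Complex.normSq w)) stdComplexGaussian
      ↔ IntegrableOn (fun r => Real.exp (-r) * g r) (Ioi 0) := by
  have hm : Measurable Complex.normSq := Complex.continuous_normSq.measurable
  have h := integrable_map_measure (μ := stdComplexGaussian) (f := Complex.normSq) (g := g)
    hg.aestronglyMeasurable hm.aemeasurable
  rw [map_normSq_stdComplexGaussian, integrable_withDensity_iff_integrable_smul' (by fun_prop)
    (by simp)] at h
  rw [← Function.comp_def, ← h, IntegrableOn]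
  simp [ENNReal.toReal_ofReal (Real.exp_pos _).le]

lemma integral_comp_normSq {g : ℝ → ℝ} (hg : Measurable g) :
    ∫ w, g (Complex.normSq w) ∂stdComplexGaussian = ∫ r in Ioi 0, Real.exp (-r) * g r := by
  have hm : Measurable Complex.normSq := Complex.continuous_normSq.measurable
  rw [← integral_map (φ := Complex.normSq) (f := g) hm.aemeasurable hg.aestronglyMeasurable,
    map_normSq_stdComplexGaussian, integral_withDensity_eq_integral_toReal_smul (by fun_prop)
    (by simp)]
  simp [ENNReal.toReal_ofReal (Real.exp_pos _).le]

lemma integral_exp_neg_normSq {s : ℝ} (hs : 0 ≤ s) :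
    ∫ w, Real.exp (-(s * Complex.normSq w)) ∂stdComplexGaussian = (1 + s)⁻¹ := by
  rw [integral_comp_normSq (g := fun r => Real.exp (-(s * r))) (by fun_prop)]
  have h := integral_exp_mul_Ioi (a := -(1 + s)) (by linarith) 0
  simp only [mul_zero, Real.exp_zero] at h
  rw [← one_div, ← neg_div_neg_eq, ← h]
  refine setIntegral_congr_fun measurableSet_Ioi fun r _ => ?_
  simp only [← Real.exp_add]
  ring_nf

lemma integrable_normSq : Integrable Complex.normSq stdComplexGaussian := by
  have h := (integrable_comp_normSq_iff (g := fun r => r) measurable_id).2 ?_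
  · exact h
  · have := Real.GammaIntegral_convergent (s := 2) two_pos
    norm_num at this
    exact this

/-- `∫ e^{-r} log r dr = Γ'(1) = -γ`, with absolute convergence. -/
lemma integrable_and_integral_log_exp :
    IntegrableOn (fun r => Real.exp (-r) * Real.log r) (Ioi 0) ∧
    ∫ r in Ioi 0, Real.exp (-r) * Real.log r = -Real.eulerMascheroniConstant := by
  have hc : Continuous fun x : ℝ => ((Real.exp (-x) : ℝ) : ℂ) := by fun_prop
  obtain ⟨h1, h2⟩ := mellin_hasDerivAt_of_isBigO_rpow (E := ℂ) (a := 2) (b := 0) (s := 1)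
    (f := fun x : ℝ => ((Real.exp (-x) : ℝ) : ℂ))
    (hc.locallyIntegrable.locallyIntegrableOn _) (by
      rw [← Asymptotics.isBigO_norm_left]
      simp_rw [Complex.norm_real, Asymptotics.isBigO_norm_left]
      simpa only [neg_one_mul] using (isLittleO_exp_neg_mul_rpow_atTop zero_lt_one _).isBigO)
    (by simp) (by
      simp_rw [neg_zero, Real.rpow_zero]
      refine Asymptotics.isBigO_const_of_tendsto (y := (1 : ℂ)) ?_ one_ne_zero
      have h0 := (hc.tendsto 0).mono_left (nhdsWithin_le_nhds (s := Ioi 0))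
      rwa [neg_zero, Real.exp_zero, Complex.ofReal_one] at h0) (by simp)
  have hcongr : ∀ r : ℝ, (r : ℂ) ^ ((1 : ℂ) - 1) • Real.log r • ((Real.exp (-r) : ℝ) : ℂ)
      = ((Real.exp (-r) * Real.log r : ℝ) : ℂ) := by
    intro r; simp [mul_comm]
  constructor
  · have h3 : IntegrableOn (fun r : ℝ => ((Real.exp (-r) * Real.log r : ℝ) : ℂ)) (Ioi 0) := by
      refine IntegrableOn.congr_fun h1 (fun r _ => hcongr r) measurableSet_Ioi
    exact (Complex.reCLM.integrable_comp h3).congr (ae_of_all _ fun r => Complex.ofReal_re _)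
  · rw [← Complex.GammaIntegral_eq_mellin] at h2
    have h4 : HasDerivAt Complex.GammaIntegral (-Real.eulerMascheroniConstant) 1 := by
      refine Complex.hasDerivAt_Gamma_one.congr_of_eventuallyEq ?_
      have : {s : ℂ | 0 < s.re} ∈ 𝓝 (1 : ℂ) :=
        (isOpen_lt continuous_const Complex.continuous_re).mem_nhds (by simp)
      filter_upwards [this] with s hs using (Complex.Gamma_eq_integral hs).symm
    have h5 := h2.unique h4
    rw [mellin] at h5
    simp only [hcongr] at h5
    rw [integral_complex_ofReal] at h5
    exact_mod_cast h5

lemma integrable_log_normSq :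
    Integrable (fun w => Real.log (Complex.normSq w)) stdComplexGaussian :=
  (integrable_comp_normSq_iff Real.measurable_log).2 integrable_and_integral_log_exp.1

lemma integral_log_normSq :
    ∫ w, Real.log (Complex.normSq w) ∂stdComplexGaussian = -Real.eulerMascheroniConstant := by
  rw [integral_comp_normSq Real.measurable_log, integrable_and_integral_log_exp.2]

lemma normSq_pos_ae : ∀ᵐ w ∂stdComplexGaussian, 0 < Complex.normSq w := by
  have hm : Measurable Complex.normSq := Complex.continuous_normSq.measurable
  have h : ∀ᵐ r ∂(stdComplexGaussian.map Complex.normSq), 0 < r := by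
    rw [map_normSq_stdComplexGaussian]
    exact (withDensity_absolutelyContinuous _ _).ae_le (ae_restrict_mem measurableSet_Ioi)
  exact ae_of_ae_map hm.aemeasurable h

/-! ### Standard complex Gaussian vectors -/

/-- The law of a vector of independent standard complex Gaussian coordinates. -/
noncomputable abbrev stdGaussianVec (ι : Type*) [Fintype ι] : Measure (ι → ℂ) :=
  Measure.pi fun _ => stdComplexGaussian

section
variable {ι : Type*} [Fintype ι]

lemma measurePreserving_eval_stdGaussianVec (i : ι) :
    MeasurePreserving (Function.eval i) (stdGaussianVec ι) stdComplexGaussian :=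
  measurePreserving_eval _ i

lemma measurable_weightedNormSq (l : ι → ℝ) :
    Measurable fun w : ι → ℂ => ∑ j, l j * Complex.normSq (w j) :=
  (continuous_finsetSum _ fun j _ =>
    continuous_const.mul (Complex.continuous_normSq.comp (continuous_apply j))).measurable

lemma integral_exp_neg_weightedNormSq {l : ι → ℝ} (hl : ∀ j, 0 ≤ l j) {t : ℝ} (ht : 0 ≤ t) :
    ∫ w, Real.exp (-(t * ∑ j, l j * Complex.normSq (w j))) ∂(stdGaussianVec ι)
      = (∏ j, (1 + t * l j))⁻¹ := by
  have h : ∀ w : ι → ℂ, Real.exp (-(t * ∑ j, l j * Complex.normSq (w j)))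
      = ∏ j, Real.exp (-(t * l j * Complex.normSq (w j))) := by
    intro w
    rw [← Real.exp_sum, Finset.sum_neg_distrib, Finset.mul_sum]
    simp only [mul_assoc]
  simp only [h]
  rw [integral_fintype_prod_eq_prod
    (f := fun j z => Real.exp (-(t * l j * Complex.normSq z))), ← Finset.prod_inv_distrib]
  exact Finset.prod_congr rfl fun j _ => integral_exp_neg_normSq (mul_nonneg ht (hl j))

lemma integrable_weightedNormSq (l : ι → ℝ) :
    Integrable (fun w : ι → ℂ => ∑ j, l j * Complex.normSq (w j)) (stdGaussianVec ι) :=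
  integrable_finsetSum _ fun j _ =>
    ((measurePreserving_eval_stdGaussianVec j).integrable_comp_of_integrable
      integrable_normSq).const_mul _

lemma weightedNormSq_pos_ae {l : ι → ℝ} (hl : ∀ j, 0 ≤ l j) {i : ι} (hi : 0 < l i) :
    ∀ᵐ w ∂(stdGaussianVec ι), 0 < ∑ j, l j * Complex.normSq (w j) := by
  filter_upwards [(measurePreserving_eval_stdGaussianVec i).quasiMeasurePreserving.ae
    normSq_pos_ae] with w hw
  exact Finset.sum_pos' (fun j _ => mul_nonneg (hl j) (Complex.normSq_nonneg _))
    ⟨i, Finset.mem_univ i, mul_pos hi hw⟩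

lemma integrable_log_weightedNormSq {l : ι → ℝ} (hl : ∀ j, 0 ≤ l j) {i : ι} (hi : 0 < l i) :
    Integrable (fun w : ι → ℂ => Real.log (∑ j, l j * Complex.normSq (w j)))
      (stdGaussianVec ι) := by
  have h1 : Integrable (fun w : ι → ℂ => Real.log (Complex.normSq (w i))) (stdGaussianVec ι) :=
    (measurePreserving_eval_stdGaussianVec i).integrable_comp_of_integrable integrable_log_normSq
  -- `log (l i) + log |w i|² ≤ log Z ≤ Z`, and both bounds are integrable
  refine Integrable.mono' (((integrable_const |Real.log (l i)|).add h1.abs).add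
    (integrable_weightedNormSq l))
    (Real.measurable_log.comp (measurable_weightedNormSq l)).aestronglyMeasurable ?_
  filter_upwards [(measurePreserving_eval_stdGaussianVec i).quasiMeasurePreserving.ae
    normSq_pos_ae] with w (hw : 0 < Complex.normSq (w i))
  have hle : l i * Complex.normSq (w i) ≤ ∑ j, l j * Complex.normSq (w j) :=
    Finset.single_le_sum (f := fun j => l j * Complex.normSq (w j))
      (fun j _ => mul_nonneg (hl j) (Complex.normSq_nonneg _)) (Finset.mem_univ i)
  have hpos := mul_pos hi hw
  have hlow := Real.log_le_log hpos hle
  rw [Real.log_mul hi.ne' hw.ne'] at hlow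
  have hup := Real.log_le_sub_one_of_pos (hpos.trans_le hle)
  have a1 := neg_abs_le (Real.log (l i))
  have a2 := neg_abs_le (Real.log (Complex.normSq (w i)))
  have a3 := abs_nonneg (Real.log (l i))
  have a4 := abs_nonneg (Real.log (Complex.normSq (w i)))
  simp only [Pi.add_apply, Real.norm_eq_abs]
  rw [abs_le]
  constructor <;> linarith [hpos.trans_le hle]

/-- The mean of `log ∑ l_j |w_j|²` as an integral of the Laplace transform `∏ (1 + t l_j)⁻¹`.
All comparisons of such means below become pointwise comparisons of these products. -/
lemma integrableOn_and_integral_log_weightedNormSq {l : ι → ℝ} (hl : ∀ j, 0 ≤ l j) {i : ι}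
    (hi : 0 < l i) :
    IntegrableOn (fun t => (Real.exp (-t) - (∏ j, (1 + t * l j))⁻¹) / t) (Ioi 0) ∧
    ∫ t in Ioi 0, (Real.exp (-t) - (∏ j, (1 + t * l j))⁻¹) / t
      = ∫ w, Real.log (∑ j, l j * Complex.normSq (w j)) ∂(stdGaussianVec ι) := by
  have h := integrableOn_and_integral_laplace (measurable_weightedNormSq l)
    (weightedNormSq_pos_ae hl hi) (integrable_log_weightedNormSq hl hi)
  have hc : EqOn (fun t => (Real.exp (-t)
        - ∫ w, Real.exp (-(t * ∑ j, l j * Complex.normSq (w j))) ∂(stdGaussianVec ι)) / t)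
      (fun t => (Real.exp (-t) - (∏ j, (1 + t * l j))⁻¹) / t) (Ioi 0) := by
    intro t ht
    simp only
    rw [integral_exp_neg_weightedNormSq hl (le_of_lt ht)]
  exact ⟨h.1.congr_fun hc measurableSet_Ioi,
    (setIntegral_congr_fun measurableSet_Ioi hc).symm.trans h.2⟩

lemma charFun_stdComplexGaussian (c : ℂ) :
    charFun stdComplexGaussian c = Complex.exp (-((‖c‖ ^ 2 : ℝ) : ℂ) / 4) := by
  rw [charFun_apply, stdComplexGaussian,
    integral_map measurable_stdComplexGaussian_map.aemeasurable (by fun_prop)]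
  have h : ∀ p : ℝ × ℝ, Complex.exp ((inner ℝ
      (((p.1 : ℂ) + Complex.I * (p.2 : ℂ)) / ((Real.sqrt 2 : ℝ) : ℂ)) c : ℝ) * Complex.I)
      = Complex.exp ((c.re / Real.sqrt 2 : ℝ) * p.1 * Complex.I)
        * Complex.exp ((c.im / Real.sqrt 2 : ℝ) * p.2 * Complex.I) := by
    intro p
    rw [← Complex.exp_add, ← add_mul]
    congr 2
    rw [Complex.inner, ← Complex.ofReal_mul, ← Complex.ofReal_mul, ← Complex.ofReal_add]
    congr 1
    simp [Complex.div_ofReal_re, Complex.div_ofReal_im, Complex.mul_re]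
    ring
  simp only [h]
  rw [integral_prod_mul (fun x : ℝ => Complex.exp ((c.re / Real.sqrt 2 : ℝ) * x * Complex.I))
    (fun x : ℝ => Complex.exp ((c.im / Real.sqrt 2 : ℝ) * x * Complex.I)),
    ← charFun_apply_real, ← charFun_apply_real, charFun_gaussianReal, charFun_gaussianReal,
    ← Complex.exp_add]
  congr 1
  have h2 : ((Real.sqrt 2 : ℝ) : ℂ) ^ 2 = 2 := by
    rw [← Complex.ofReal_pow, Real.sq_sqrt (by norm_num)]; norm_num
  rw [← Complex.normSq_eq_norm_sq, Complex.normSq_apply]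
  push_cast
  rw [div_pow, div_pow, h2]
  simp
  ring

/-- Unitary invariance, read off from the characteristic function `e^{-‖t‖² / 4}`. -/
lemma map_unitary_stdGaussianVec [DecidableEq ι] (U : Matrix ι ι ℂ)
    (hU : U ∈ Matrix.unitaryGroup ι ℂ) :
    (stdGaussianVec ι).map (fun w => U *ᵥ w) = stdGaussianVec ι := by
  have hm : Measurable fun w : ι → ℂ => U *ᵥ w := by
    exact (Continuous.matrix_mulVec continuous_const continuous_id).measurable
  have : IsProbabilityMeasure ((stdGaussianVec ι).map fun w => U *ᵥ w) :=
    Measure.isProbabilityMeasure_map hm.aemeasurable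
  refine (charFun_eq_pi_iff (μ := fun _ : ι => stdComplexGaussian)).1 fun t => ?_
  have key : charFun (((stdGaussianVec ι).map fun w => U *ᵥ w).map (WithLp.toLp 2)) t
      = charFun ((stdGaussianVec ι).map (WithLp.toLp 2)) (WithLp.toLp 2 (Uᴴ *ᵥ t.ofLp)) := by
    rw [charFun_apply, charFun_apply, Measure.map_map (by fun_prop) hm,
      integral_map (by fun_prop) (by fun_prop), integral_map (by fun_prop) (by fun_prop)]
    refine integral_congr_ae (ae_of_all _ fun w => ?_)
    simp only [Function.comp]
    congr 3
    simp only [PiLp.inner_apply, Complex.inner]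
    simp only [Matrix.mulVec, dotProduct, map_sum, map_mul, Finset.sum_mul, Finset.mul_sum,
      Matrix.conjTranspose_apply, Complex.re_sum, RCLike.star_def]
    rw [Finset.sum_comm]
    refine Finset.sum_congr rfl fun i _ => Finset.sum_congr rfl fun j _ => ?_
    congr 1
    ring
  rw [key, charFun_pi]
  simp only [charFun_stdComplexGaussian, ← Complex.exp_sum]
  congr 1
  simp only [neg_div]
  rw [Finset.sum_neg_distrib, Finset.sum_neg_distrib, ← Finset.sum_div, ← Finset.sum_div,
    ← Complex.ofReal_sum, ← Complex.ofReal_sum]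
  congr 3
  have hn : ∀ s : ι → ℂ, ((∑ j, ‖s j‖ ^ 2 : ℝ) : ℂ) = star s ⬝ᵥ s := by
    intro s
    rw [dotProduct, Complex.ofReal_sum]
    refine Finset.sum_congr rfl fun j _ => ?_
    rw [Pi.star_apply, RCLike.star_def, Complex.conj_mul', Complex.ofReal_pow]
  apply Complex.ofReal_injective
  rw [hn, hn, Matrix.star_mulVec, Matrix.conjTranspose_conjTranspose, Matrix.dotProduct_mulVec,
    Matrix.vecMul_vecMul]
  rw [show U * Uᴴ = 1 from Matrix.mem_unitaryGroup_iff.1 hU, Matrix.vecMul_one]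

end

/-! ### The constants as integrals -/

/-- `𝔼 log (a E₀ + b (E₁ + ⋯ + E_m))` for independent unit exponentials `E_j`, written as the
integral of its Laplace transform. -/
noncomputable def logMean (a b : ℝ) (m : ℕ) : ℝ :=
  ∫ t in Ioi 0, (Real.exp (-t) - ((1 + t * a) * (1 + t * b) ^ m)⁻¹) / t

lemma integrableOn_logMean {a b : ℝ} (ha : 0 < a) (hb : 0 ≤ b) (m : ℕ) :
    IntegrableOn (fun t => (Real.exp (-t) - ((1 + t * a) * (1 + t * b) ^ m)⁻¹) / t) (Ioi 0) := by
  have h := (integrableOn_and_integral_log_weightedNormSq (ι := Option (Fin m))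
    (l := fun j => j.elim a fun _ => b) (by rintro (_ | _) <;> simp [ha.le, hb]) (i := none)
    (by simpa using ha)).1
  simpa [Fintype.prod_option] using h

lemma logMean_zero {a : ℝ} (ha : 0 < a) (b : ℝ) :
    logMean a b 0 = Real.log a - Real.eulerMascheroniConstant := by
  have h := (integrableOn_and_integral_log_weightedNormSq (ι := Unit)
    (l := fun _ => a) (fun _ => ha.le) (i := ()) ha).2
  simp only [Finset.univ_unique, Finset.prod_singleton, Finset.sum_singleton] at h
  rw [logMean]
  simp only [pow_zero, mul_one]
  rw [h]
  have hp := measurePreserving_eval_stdGaussianVec (default : Unit)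
  have h2 : ∫ w, Real.log (a * Complex.normSq (w default)) ∂(stdGaussianVec Unit)
      = ∫ w, (Real.log a + Real.log (Complex.normSq (w default))) ∂(stdGaussianVec Unit) := by
    refine integral_congr_ae ?_
    filter_upwards [hp.quasiMeasurePreserving.ae normSq_pos_ae] with w hw
    exact Real.log_mul ha.ne' (ne_of_gt hw)
  have hint : Integrable (fun w : Unit → ℂ => Real.log (Complex.normSq (w default)))
      (stdGaussianVec Unit) := hp.integrable_comp_of_integrable integrable_log_normSq
  rw [h2, integral_add (integrable_const _) hint, integral_const]
  have h3 : ∫ w, Real.log (Complex.normSq (w default)) ∂(stdGaussianVec Unit)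
      = -Real.eulerMascheroniConstant := by
    have h4 := integral_map (f := fun z => Real.log (Complex.normSq z))
      hp.measurable.aemeasurable ?_ (μ := stdGaussianVec Unit)
    · rw [hp.map_eq, integral_log_normSq] at h4
      exact h4.symm
    · exact (Real.measurable_log.comp Complex.continuous_normSq.measurable).aestronglyMeasurable
  rw [h3]
  simp [sub_eq_add_neg]

/-- Partial fractions in the Laplace transform. -/
lemma logMean_succ {a b : ℝ} (ha : 0 < a) (hb : 0 < b) (hab : a ≠ b) (m : ℕ) :
    logMean a b (m + 1) = a / (a - b) * logMean a b m - b / (a - b) * logMean b b m := by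
  have hab' : a - b ≠ 0 := sub_ne_zero.2 hab
  rw [logMean, logMean, logMean, ← integral_const_mul, ← integral_const_mul,
    ← integral_sub ((integrableOn_logMean ha hb.le m).const_mul _)
      ((integrableOn_logMean hb hb.le m).const_mul _)]
  refine setIntegral_congr_fun measurableSet_Ioi fun t (ht : 0 < t) => ?_
  have h1 : 1 + t * a ≠ 0 := by positivity
  have h2 : 1 + t * b ≠ 0 := by positivity
  field_simp
  ring

lemma integral_inv_pow_linear {b : ℝ} (hb : 0 < b) (m : ℕ) :
    ∫ t in Ioi 0, b * ((1 + t * b) ^ (m + 2))⁻¹ = ((m : ℝ) + 1)⁻¹ := by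
  have hd : ∀ t ∈ Ici (0 : ℝ), HasDerivAt
      (fun t => -(((m : ℝ) + 1)⁻¹ * ((1 + t * b) ^ (m + 1))⁻¹)) (b * ((1 + t * b) ^ (m + 2))⁻¹) t := by
    intro t ht
    have ht' : 0 ≤ t := ht
    have hne : 1 + t * b ≠ 0 := by positivity
    have h := ((((((hasDerivAt_id t).mul_const b).const_add 1).pow (m + 1)).inv
      (pow_ne_zero _ hne)).const_mul ((m : ℝ) + 1)⁻¹).neg
    refine h.congr_deriv ?_
    have : (m : ℝ) + 1 ≠ 0 := by positivity
    simp
    field_simp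
    ring
  have ht : Tendsto (fun t => -(((m : ℝ) + 1)⁻¹ * ((1 + t * b) ^ (m + 1))⁻¹)) atTop (𝓝 0) := by
    have h1 : Tendsto (fun t : ℝ => (1 + t * b) ^ (m + 1)) atTop atTop :=
      (tendsto_pow_atTop (Nat.succ_ne_zero m)).comp
        (tendsto_atTop_add_const_left _ _ (tendsto_id.atTop_mul_const hb))
    simpa using ((tendsto_inv_atTop_zero.comp h1).const_mul ((m : ℝ) + 1)⁻¹).neg
  rw [integral_Ioi_of_hasDerivAt_of_nonneg' hd (fun t (h : 0 < t) => by positivity) ht]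
  simp

lemma logMean_self {b : ℝ} (hb : 0 < b) (m : ℕ) :
    logMean b b m = Real.log b - Real.eulerMascheroniConstant + harmonic m := by
  induction m with
  | zero => simp [logMean_zero hb]
  | succ m ih =>
    have h : logMean b b (m + 1) - logMean b b m = ((m : ℝ) + 1)⁻¹ := by
      rw [← integral_inv_pow_linear hb m, logMean, logMean,
        ← integral_sub (integrableOn_logMean hb hb.le _) (integrableOn_logMean hb hb.le _)]
      refine setIntegral_congr_fun measurableSet_Ioi fun t (ht : 0 < t) => ?_
      have h2 : 1 + t * b ≠ 0 := by positivity
      field_simp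
      ring
    rw [harmonic_succ, eq_add_of_sub_eq h, ih]
    push_cast
    ring

lemma digamma_nat_add_one (m : ℕ) :
    digamma ((m : ℝ) + 1) = -Real.eulerMascheroniConstant + harmonic m := by
  have hG : Real.Gamma ((m : ℝ) + 1) ≠ 0 := (Real.Gamma_pos_of_pos (by positivity)).ne'
  rw [digamma, ((Real.hasDerivAt_Gamma_nat m).log hG).deriv, Real.Gamma_nat_eq_factorial]
  field_simp

/-- The closed form of `logMean` obtained by iterating the partial fraction recursion. -/
lemma logMean_eq_sum {a b : ℝ} (ha : 0 < a) (hb : 0 < b) (hab : a ≠ b) (m : ℕ) :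
    logMean a b m = (a / (a - b)) ^ m * (Real.log a - Real.eulerMascheroniConstant)
      - ∑ l ∈ Finset.range m, b / (a - b) * (a / (a - b)) ^ l
          * (Real.log b + digamma ((m : ℝ) - l)) := by
  induction m with
  | zero => simp [logMean_zero ha]
  | succ m ih =>
    rw [logMean_succ ha hb hab, ih, logMean_self hb, Finset.sum_range_succ', mul_sub,
      Finset.mul_sum, Nat.cast_succ, Nat.cast_zero, sub_zero, digamma_nat_add_one]
    have : ∀ l : ℕ, (m : ℝ) + 1 - ((l + 1 : ℕ) : ℝ) = m - l := by
      intro l; push_cast; ring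
    simp only [this]
    have h2 : ∀ l : ℕ, a / (a - b) * (b / (a - b) * (a / (a - b)) ^ l
        * (Real.log b + digamma ((m : ℝ) - l)))
        = b / (a - b) * (a / (a - b)) ^ (l + 1) * (Real.log b + digamma ((m : ℝ) - l)) := by
      intro l; ring
    simp only [h2]
    ring

/-- At `k = 1` the two weights agree and the partial fraction formula breaks down, but the integral
does not: it covers every level. -/
lemma Cconst_eq {n k : ℕ} (hn : 1 ≤ n) (hk : 1 ≤ k) :
    Cconst n k = Real.eulerMascheroniConstant
      + logMean (k / (k + n - 1)) (1 / (k + n - 1)) (n - 1) := by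
  obtain ⟨m, rfl⟩ : ∃ m, n = m + 1 := ⟨n - 1, by omega⟩
  have hk0 : (0 : ℝ) < k := by exact_mod_cast hk
  have hs : (k : ℝ) + ((m + 1 : ℕ) : ℝ) - 1 = k + m := by push_cast; ring
  have hs0 : (0 : ℝ) < k + m := by positivity
  rw [Cconst, hs, Nat.add_sub_cancel]
  split_ifs with h1
  · subst h1
    rw [Lconst, Nat.cast_one, logMean_self (by positivity), Nat.cast_succ, digamma_nat_add_one,
      one_div, Real.log_inv, add_comm (1 : ℝ)]
    ring
  have hk1 : (1 : ℝ) < k := by exact_mod_cast (by omega : 1 < k)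
  rcases Nat.eq_zero_or_pos m with rfl | hm
  · rw [logMean_zero (by positivity)]
    simp [Cexpr]
  have hm0 : (0 : ℝ) < m := by exact_mod_cast hm
  have hb : (1 - (k : ℝ) / (k + m)) / (((m + 1 : ℕ) : ℝ) - 1) = 1 / (k + m) := by
    push_cast; rw [add_sub_cancel_right]; field_simp; ring
  have hab : (k : ℝ) / (k + m) - 1 / (k + m) ≠ 0 := by
    rw [← sub_div]; exact (div_pos (by linarith) hs0).ne'
  rw [logMean_eq_sum (by positivity) (by positivity) (sub_ne_zero.1 hab), Cexpr]
  simp only [hb, sub_sub_cancel, Nat.add_sub_cancel]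
  rw [show Finset.Icc 1 m = Finset.Ico 1 (m + 1) from rfl, Finset.sum_Ico_eq_sum_range,
    Nat.add_sub_cancel, div_pow, add_sub_assoc]
  congr 2
  · ring
  · refine Finset.sum_congr rfl fun l _ => ?_
    have e1 : ((m + 1 : ℕ) : ℝ) - ((1 + l : ℕ) : ℝ) = m - l := by push_cast; ring
    have e2 : 1 - (k : ℝ) / (k + m) = 1 / (k + m) * m := by field_simp; ring
    have e3 : ((m + 1 : ℕ) : ℝ) - 1 = m := by push_cast; ring
    rw [e1, e2, e3, Nat.add_sub_cancel_left, pow_add, pow_one]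
    generalize (k : ℝ) / (k + m) - 1 / (k + m) = c at hab ⊢
    generalize (k : ℝ) / (k + m) = a
    rw [div_pow a c l]
    field_simp

/-! ### Comparison of products of linear factors -/

section
variable {ι : Type*} [Fintype ι]

lemma prod_div_le_exp (x y : ι → ℝ) (hx : ∀ j, 0 < x j) (hy : ∀ j, 0 < y j) :
    ∏ j, x j / y j ≤ Real.exp (∑ j, (x j / y j - 1)) := by
  rw [Real.exp_sum]
  refine Finset.prod_le_prod (fun j _ => (div_pos (hx j) (hy j)).le) fun j _ => ?_
  linarith [Real.add_one_le_exp (x j / y j - 1)]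

/-- A form of the inequality between arithmetic and geometric means. -/
lemma prod_le_prod_of_sum_div_le {x y : ι → ℝ} (hx : ∀ j, 0 < x j) (hy : ∀ j, 0 < y j)
    (h : ∑ j, (x j / y j - 1) ≤ 0) : ∏ j, x j ≤ ∏ j, y j := by
  have h1 := (prod_div_le_exp x y hx hy).trans (Real.exp_le_one_iff.2 h)
  rwa [Finset.prod_div_distrib, div_le_one (Finset.prod_pos fun j _ => hy j)] at h1

lemma prod_lt_prod_of_sum_div_le {x y : ι → ℝ} (hx : ∀ j, 0 < x j) (hy : ∀ j, 0 < y j)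
    (h : ∑ j, (x j / y j - 1) ≤ 0) {i : ι} (hi : x i ≠ y i) : ∏ j, x j < ∏ j, y j := by
  have h1 : ∏ j, x j / y j < Real.exp (∑ j, (x j / y j - 1)) := by
    rw [Real.exp_sum]
    refine Finset.prod_lt_prod (fun j _ => div_pos (hx j) (hy j)) (fun j _ => ?_)
      ⟨i, Finset.mem_univ i, ?_⟩
    · linarith [Real.add_one_le_exp (x j / y j - 1)]
    · have hne : x i / y i - 1 ≠ 0 := by
        rw [sub_ne_zero, Ne, div_eq_one_iff_eq (hy i).ne']; exact hi
      linarith [Real.add_one_lt_exp hne]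
  have h2 := h1.trans_le (Real.exp_le_one_iff.2 h)
  rwa [Finset.prod_div_distrib, div_lt_one (Finset.prod_pos fun j _ => hy j)] at h2

/-- The weights `a, b, …, b`, with `a` at `i`. -/
def twoLevel [DecidableEq ι] (i : ι) (a b : ℝ) : ι → ℝ := fun j => if j = i then a else b

lemma prod_one_add_twoLevel [DecidableEq ι] (i : ι) (a b t : ℝ) :
    ∏ j, (1 + t * twoLevel i a b j) = (1 + t * a) * (1 + t * b) ^ (Fintype.card ι - 1) := by
  rw [← Finset.mul_prod_erase _ _ (Finset.mem_univ i)]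
  congr 1
  · simp [twoLevel]
  · rw [Finset.prod_congr rfl (g := fun _ => 1 + t * b), Finset.prod_const,
      Finset.card_erase_of_mem (Finset.mem_univ i), Finset.card_univ]
    intro j hj
    simp [twoLevel, Finset.ne_of_mem_erase hj]

/-- The hypothesis of `prod_le_prod_of_sum_div_le` for weights `l` of the same total as `a, b, …, b`
whose entry at `i` is at least `a`: the excess at `i` is divided by the larger factor `1 + t a`. -/
lemma sum_div_twoLevel_le [DecidableEq ι] {l : ι → ℝ} {i : ι} {a b t : ℝ} (ht : 0 ≤ t)
    (hb : 0 ≤ b) (hab : b ≤ a) (hi : a ≤ l i)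
    (hsum : ∑ j, l j = a + ((Fintype.card ι : ℝ) - 1) * b) :
    ∑ j, ((1 + t * l j) / (1 + t * twoLevel i a b j) - 1) ≤ 0 := by
  have hbp : 0 < 1 + t * b := by positivity
  have hap : 0 < 1 + t * a := by nlinarith
  have h1 : ∀ j, (1 + t * l j) / (1 + t * twoLevel i a b j) - 1
      = ((1 + t * l j) / (1 + t * b) - 1)
        + (if j = i then (1 + t * l i) * (1 / (1 + t * a) - 1 / (1 + t * b)) else 0) := by
    intro j
    by_cases hj : j = i
    · subst hj; simp only [twoLevel, if_true]; ring
    · simp [twoLevel, hj]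
  simp only [h1]
  rw [Finset.sum_add_distrib, Finset.sum_ite_eq' , if_pos (Finset.mem_univ i),
    Finset.sum_sub_distrib, ← Finset.sum_div, Finset.sum_add_distrib, ← Finset.mul_sum, hsum]
  simp only [Finset.sum_const, Finset.card_univ, nsmul_eq_mul, mul_one]
  have h2 : 1 / (1 + t * a) - 1 / (1 + t * b) ≤ 0 := by
    rw [sub_nonpos]
    exact one_div_le_one_div_of_le hbp (by nlinarith)
  have h3 : (1 + t * l i) * (1 / (1 + t * a) - 1 / (1 + t * b))
      ≤ (1 + t * a) * (1 / (1 + t * a) - 1 / (1 + t * b)) :=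
    mul_le_mul_of_nonpos_right (by nlinarith) h2
  refine (add_le_add_right h3 _).trans (le_of_eq ?_)
  field_simp
  ring

end

/-! ### Monotonicity of the constants -/

lemma logMean_integrand_le {p q t : ℝ} (ht : 0 < t) (hp : 0 < p) (h : p ≤ q) :
    (Real.exp (-t) - p⁻¹) / t ≤ (Real.exp (-t) - q⁻¹) / t :=
  div_le_div_of_nonneg_right (sub_le_sub_left (inv_anti₀ hp h) _) ht.le

section
variable {m k k' : ℕ}

/-- Raising the level from `k` to `k'` makes the weights more unequal. -/
lemma sum_div_level_le (hk : 1 ≤ k) (hkk : k ≤ k') {t : ℝ} (ht : 0 < t) :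
    ∑ j : Option (Fin m),
      ((1 + t * twoLevel none ((k' : ℝ) / (k' + m)) (1 / (k' + m)) j)
        / (1 + t * twoLevel none ((k : ℝ) / (k + m)) (1 / (k + m)) j) - 1) ≤ 0 := by
  have hk0 : (1 : ℝ) ≤ k := by exact_mod_cast hk
  have hkk' : (k : ℝ) ≤ k' := by exact_mod_cast hkk
  have hk0' : (1 : ℝ) ≤ k' := hk0.trans hkk'
  have hm : (0 : ℝ) ≤ m := m.cast_nonneg
  refine sum_div_twoLevel_le ht.le (by positivity) (by gcongr) ?_ ?_
  · simp only [twoLevel, if_true]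
    rw [div_le_div_iff₀ (by positivity) (by positivity)]
    nlinarith
  · rw [Fintype.sum_option]
    simp [twoLevel]
    field_simp

lemma twoLevel_pos {ι : Type*} [DecidableEq ι] {i : ι} {a b t : ℝ} (ha : 0 ≤ a) (hb : 0 ≤ b)
    (ht : 0 < t) (j : ι) : 0 < 1 + t * twoLevel i a b j := by
  unfold twoLevel; split_ifs <;> positivity

lemma logMean_level_anti (hk : 1 ≤ k) (hkk : k ≤ k') :
    logMean ((k' : ℝ) / (k' + m)) (1 / (k' + m)) m
      ≤ logMean ((k : ℝ) / (k + m)) (1 / (k + m)) m := by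
  have hk0 : (1 : ℝ) ≤ k := by exact_mod_cast hk
  have hk0' : (1 : ℝ) ≤ k' := by exact_mod_cast hk.trans hkk
  refine setIntegral_mono_on (integrableOn_logMean (by positivity) (by positivity) m)
    (integrableOn_logMean (by positivity) (by positivity) m) measurableSet_Ioi
    fun t (ht : 0 < t) => logMean_integrand_le ht (by positivity) ?_
  have h := prod_le_prod_of_sum_div_le (twoLevel_pos (by positivity) (by positivity) ht)
    (twoLevel_pos (by positivity) (by positivity) ht) (sum_div_level_le (m := m) hk hkk ht)
  simpa [prod_one_add_twoLevel] using h

lemma logMean_level_strictAnti (hm : 1 ≤ m) (hk : 1 ≤ k) (hkk : k < k') :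
    logMean ((k' : ℝ) / (k' + m)) (1 / (k' + m)) m
      < logMean ((k : ℝ) / (k + m)) (1 / (k + m)) m := by
  have hk0 : (1 : ℝ) ≤ k := by exact_mod_cast hk
  have hkk' : (k : ℝ) < k' := by exact_mod_cast hkk
  have hm' : (1 : ℝ) ≤ m := by exact_mod_cast hm
  have hk0' : (1 : ℝ) ≤ k' := by linarith
  have hlt : ∀ t ∈ Ioi (0 : ℝ),
      (Real.exp (-t) - ((1 + t * ((k' : ℝ) / (k' + m))) * (1 + t * (1 / (k' + m))) ^ m)⁻¹) / t
      < (Real.exp (-t) - ((1 + t * ((k : ℝ) / (k + m))) * (1 + t * (1 / (k + m))) ^ m)⁻¹) / t := by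
    intro t (ht : 0 < t)
    refine div_lt_div_of_pos_right (sub_lt_sub_left (inv_strictAnti₀ (by positivity) ?_) _) ht
    have h := prod_lt_prod_of_sum_div_le (twoLevel_pos (by positivity) (by positivity) ht)
      (twoLevel_pos (by positivity) (by positivity) ht)
      (sum_div_level_le (m := m) hk hkk.le ht) (i := none) (by
        simp only [twoLevel, if_true]
        refine (add_lt_add_right (mul_lt_mul_of_pos_left ?_ ht) 1).ne'
        rw [div_lt_div_iff₀ (by positivity) (by positivity)]
        nlinarith)
    simpa [prod_one_add_twoLevel] using h
  have hi := integrableOn_logMean (a := (k : ℝ) / (k + m)) (b := 1 / (k + m)) (by positivity)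
    (by positivity) m
  have hi' := integrableOn_logMean (a := (k' : ℝ) / (k' + m)) (b := 1 / (k' + m)) (by positivity)
    (by positivity) m
  rw [logMean, logMean, ← sub_pos, ← integral_sub hi hi',
    setIntegral_pos_iff_support_of_nonneg_ae ?_
      (show IntegrableOn (fun t => _ - _) _ _ from hi.sub hi')]
  · have hsub : Ioi (0 : ℝ) ⊆ Function.support (fun t =>
        (Real.exp (-t) - ((1 + t * ((k : ℝ) / (k + m))) * (1 + t * (1 / (k + m))) ^ m)⁻¹) / t
        - (Real.exp (-t)
            - ((1 + t * ((k' : ℝ) / (k' + m))) * (1 + t * (1 / (k' + m))) ^ m)⁻¹) / t) :=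
      fun t ht => (sub_pos.2 (hlt t ht)).ne'
    rw [inter_eq_right.2 hsub]
    simp
  · filter_upwards [ae_restrict_mem measurableSet_Ioi] with t ht
    exact (sub_pos.2 (hlt t ht)).le

end

lemma neg_eulerMascheroni_le_logMean {a b : ℝ} (ha : 0 < a) (hb : 0 ≤ b) {m : ℕ}
    (h : a + m * b = 1) : -Real.eulerMascheroniConstant ≤ logMean a b m := by
  have h0 : logMean 1 0 0 = -Real.eulerMascheroniConstant := by simp [logMean_zero one_pos]
  rw [← h0]
  refine setIntegral_mono_on (integrableOn_logMean one_pos le_rfl 0)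
    (integrableOn_logMean ha hb m) measurableSet_Ioi
    fun t (ht : 0 < t) => logMean_integrand_le ht (by positivity) ?_
  have h1 := one_add_mul_le_pow (a := t * b) (by nlinarith [mul_nonneg ht.le hb]) m
  have h2 : 1 + t = 1 + t * (a + m * b) := by rw [h, mul_one]
  have h3 : 0 ≤ t * a * (m * (t * b)) := by positivity
  have h4 := mul_le_mul_of_nonneg_left h1 (by positivity : 0 ≤ 1 + t * a)
  rw [pow_zero, mul_one, mul_one, h2]
  linarith

section
variable {n : ℕ}

lemma Cconst_succ_eq (m : ℕ) {k : ℕ} (hk : 1 ≤ k) : Cconst (m + 1) k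
    = Real.eulerMascheroniConstant + logMean (k / (k + m)) (1 / (k + m)) m := by
  rw [Cconst_eq (by omega) hk, show (k : ℝ) + ((m + 1 : ℕ) : ℝ) - 1 = k + m by push_cast; ring,
    Nat.add_sub_cancel]

lemma antitoneOn_Cconst (hn : 1 ≤ n) : AntitoneOn (Cconst n) (Ici 1) := by
  intro k (hk : 1 ≤ k) k' (hk' : 1 ≤ k') hkk
  obtain ⟨m, rfl⟩ : ∃ m, n = m + 1 := ⟨n - 1, by omega⟩
  rw [Cconst_succ_eq m hk, Cconst_succ_eq m hk']
  exact add_le_add_right (logMean_level_anti hk hkk) _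

lemma strictAntiOn_Cconst (hn : 2 ≤ n) : StrictAntiOn (Cconst n) (Ici 1) := by
  intro k (hk : 1 ≤ k) k' (hk' : 1 ≤ k') hkk
  obtain ⟨m, rfl⟩ : ∃ m, n = m + 1 := ⟨n - 1, by omega⟩
  rw [Cconst_succ_eq m hk, Cconst_succ_eq m hk']
  exact add_lt_add_right (logMean_level_strictAnti (by omega) hk hkk) _

lemma Cconst_nonneg {k : ℕ} (hn : 1 ≤ n) (hk : 1 ≤ k) : 0 ≤ Cconst n k := by
  obtain ⟨m, rfl⟩ : ∃ m, n = m + 1 := ⟨n - 1, by omega⟩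
  have hk0 : (1 : ℝ) ≤ k := by exact_mod_cast hk
  rw [Cconst_succ_eq m hk]
  linarith [neg_eulerMascheroni_le_logMean (a := k / (k + m)) (b := 1 / (k + m)) (m := m)
    (by positivity) (by positivity) (by field_simp)]

lemma Cconst_le_Lconst {k : ℕ} (hn : 1 ≤ n) (hk : 1 ≤ k) : Cconst n k ≤ Lconst n := by
  have h := antitoneOn_Cconst hn (mem_Ici.2 le_rfl) (mem_Ici.2 hk) hk
  rwa [Cconst.eq_def n 1, if_pos rfl] at h

end

/-! ### Mean logarithms of weighted sums -/

lemma one_add_sum_le_prod {ι : Type*} (s : Finset ι) {x : ι → ℝ} (hx : ∀ j, 0 ≤ x j) :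
    1 + ∑ j ∈ s, x j ≤ ∏ j ∈ s, (1 + x j) := by
  classical
  induction s using Finset.induction_on with
  | empty => simp
  | insert a s ha ih =>
    rw [Finset.sum_insert ha, Finset.prod_insert ha]
    have h := mul_le_mul_of_nonneg_left ih (add_nonneg zero_le_one (hx a))
    have h2 := mul_nonneg (hx a) (Finset.sum_nonneg fun j (_ : j ∈ s) => hx j)
    linarith

section
variable {ι : Type*} [Fintype ι]

lemma exists_pos_of_sum_pos {l : ι → ℝ} (hl : 0 < ∑ j, l j) : ∃ i, 0 < l i := by
  obtain ⟨i, -, hi⟩ := Finset.exists_lt_of_sum_lt (s := Finset.univ) (f := fun _ => (0 : ℝ))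
    (g := l) (by simpa using hl)
  exact ⟨i, hi⟩

lemma log_sum_sub_le_integral_log {l : ι → ℝ} (hl : ∀ j, 0 ≤ l j) (hsum : 0 < ∑ j, l j) :
    Real.log (∑ j, l j) - Real.eulerMascheroniConstant
      ≤ ∫ w, Real.log (∑ j, l j * Complex.normSq (w j)) ∂(stdGaussianVec ι) := by
  obtain ⟨i, hi⟩ := exists_pos_of_sum_pos hsum
  obtain ⟨h1, h2⟩ := integrableOn_and_integral_log_weightedNormSq hl hi
  rw [← h2, ← logMean_zero hsum 0]
  refine setIntegral_mono_on (integrableOn_logMean hsum le_rfl 0) h1 measurableSet_Ioi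
    fun t (ht : 0 < t) => logMean_integrand_le ht (by positivity) ?_
  have h := one_add_sum_le_prod Finset.univ (x := fun j => t * l j)
    fun j => mul_nonneg ht.le (hl j)
  rw [← Finset.mul_sum] at h
  simpa using h

lemma integral_log_le_logMean {l : ι → ℝ} (hl : ∀ j, 0 ≤ l j) {i : ι} {a b : ℝ} (hb : 0 < b)
    (hab : b ≤ a) (hi : a ≤ l i) (hsum : ∑ j, l j = a + ((Fintype.card ι : ℝ) - 1) * b) :
    ∫ w, Real.log (∑ j, l j * Complex.normSq (w j)) ∂(stdGaussianVec ι)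
      ≤ logMean a b (Fintype.card ι - 1) := by
  classical
  have ha : 0 < a := hb.trans_le hab
  obtain ⟨h1, h2⟩ := integrableOn_and_integral_log_weightedNormSq hl (ha.trans_le hi)
  rw [← h2]
  have hpos : ∀ t, 0 < t → ∀ j, 0 < 1 + t * l j := fun t ht j => by
    have := mul_nonneg ht.le (hl j)
    linarith
  refine setIntegral_mono_on h1 (integrableOn_logMean ha hb.le _) measurableSet_Ioi
    fun t (ht : 0 < t) => logMean_integrand_le ht (Finset.prod_pos fun j _ => hpos t ht j) ?_
  rw [← prod_one_add_twoLevel i]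
  exact prod_le_prod_of_sum_div_le (hpos t ht) (twoLevel_pos ha.le hb.le ht)
    (sum_div_twoLevel_le ht.le hb.le hab hi hsum)

/-- Among weights of given total whose largest is at least the fraction `k / (k + n - 1)`, the mean
logarithm is largest when the remaining weights are equal and the constraint is tight; this extremal
value is `log T + C(n, k) - γ`. -/
lemma integral_log_le_Cconst {l : ι → ℝ} (hl : ∀ j, 0 ≤ l j) (hT : 0 < ∑ j, l j) {k : ℕ}
    (hk : 1 ≤ k) {i : ι}
    (hi : (k : ℝ) / (k + Fintype.card ι - 1) * ∑ j, l j ≤ l i) :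
    ∫ w, Real.log (∑ j, l j * Complex.normSq (w j)) ∂(stdGaussianVec ι)
      ≤ Real.log (∑ j, l j) + Cconst (Fintype.card ι) k - Real.eulerMascheroniConstant := by
  have hcard : 1 ≤ Fintype.card ι := Fintype.card_pos_iff.2 ⟨i⟩
  have hc : (1 : ℝ) ≤ Fintype.card ι := by exact_mod_cast hcard
  have hk0 : (1 : ℝ) ≤ k := by exact_mod_cast hk
  have hden : (0 : ℝ) < k + Fintype.card ι - 1 := by linarith
  set T := ∑ j, l j with hTdef
  have hl' : ∀ j, 0 ≤ l j / T := fun j => div_nonneg (hl j) hT.le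
  have hi' : (k : ℝ) / (k + Fintype.card ι - 1) ≤ l i / T := (le_div_iff₀ hT).2 hi
  have hipos : 0 < l i / T := lt_of_lt_of_le (by positivity) hi'
  have h := integral_log_le_logMean hl' (b := 1 / (k + Fintype.card ι - 1)) (by positivity)
    (by gcongr) hi' (by
      rw [← Finset.sum_div, ← hTdef, div_self hT.ne']
      field_simp
      ring)
  have hscale : ∫ w, Real.log (∑ j, l j * Complex.normSq (w j)) ∂(stdGaussianVec ι)
      = ∫ w, (Real.log T + Real.log (∑ j, l j / T * Complex.normSq (w j))) ∂(stdGaussianVec ι) := by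
    refine integral_congr_ae ?_
    filter_upwards [weightedNormSq_pos_ae hl' hipos] with w hw
    rw [← Real.log_mul hT.ne' hw.ne', Finset.mul_sum]
    congr 1
    refine Finset.sum_congr rfl fun j _ => ?_
    field_simp
  rw [hscale, integral_add (integrable_const _) (integrable_log_weightedNormSq hl' hipos),
    Cconst_eq hcard hk]
  simp only [integral_const, probReal_univ, one_smul]
  linarith

end

/-! ### Quadratic forms of Gaussian vectors -/

section
variable {n : ℕ} {H : Matrix (Fin n) (Fin n) ℂ}

lemma quadForm_toLp_diagonal (l : Fin n → ℝ) (w : Fin n → ℂ) :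
    quadForm (Matrix.diagonal fun j => (l j : ℂ)) (WithLp.toLp 2 w)
      = ∑ j, l j * Complex.normSq (w j) := by
  simp only [quadForm, dotProduct, Matrix.mulVec_diagonal, Complex.re_sum]
  refine Finset.sum_congr rfl fun j _ => ?_
  simp [Complex.normSq_apply]
  ring

lemma quadForm_conj (B A : Matrix (Fin n) (Fin n) ℂ) (w : Fin n → ℂ) :
    quadForm A (WithLp.toLp 2 (B *ᵥ w)) = quadForm (Bᴴ * A * B) (WithLp.toLp 2 w) := by
  simp only [quadForm, Matrix.star_mulVec, ← Matrix.mulVec_mulVec, Matrix.dotProduct_mulVec,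
    Matrix.vecMul_vecMul]

lemma quadForm_one (x : Vec n) : quadForm 1 x = ‖x‖ ^ 2 := by
  rw [← eval_quadPoly, ← eval_normSqPoly, eval_quadPoly, eval_normSqPoly, quadForm,
    Matrix.one_mulVec, EuclideanSpace.norm_sq_eq, dotProduct, Complex.re_sum]
  refine Finset.sum_congr rfl fun j _ => ?_
  simp [← Complex.normSq_eq_norm_sq, Complex.normSq_apply]

lemma quadForm_nonneg (hH : H.PosSemidef) (x : Vec n) : 0 ≤ quadForm H x :=
  (Complex.le_def.1 (hH.dotProduct_mulVec_nonneg x.ofLp)).1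

/-- In an eigenbasis the quadratic form is a weighted sum of squared moduli. -/
lemma quadForm_eq_sum_eigenvalues (hH : H.IsHermitian) (w : Fin n → ℂ) :
    quadForm H (WithLp.toLp 2 w) = ∑ j, hH.eigenvalues j
      * Complex.normSq (((hH.eigenvectorUnitary : Matrix (Fin n) (Fin n) ℂ)ᴴ *ᵥ w) j) := by
  rw [← quadForm_toLp_diagonal, quadForm_conj, Matrix.conjTranspose_conjTranspose]
  congr 1
  conv_lhs => rw [hH.spectral_theorem, Unitary.conjStarAlgAut_apply]
  rfl

lemma trace_re_eq_sum_eigenvalues (hH : H.IsHermitian) :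
    H.trace.re = ∑ j, hH.eigenvalues j := by
  rw [hH.trace_eq_sum_eigenvalues, Complex.re_sum]
  rfl

lemma measurePreserving_eigenvectorUnitary (hH : H.IsHermitian) : MeasurePreserving
    (fun w => (hH.eigenvectorUnitary : Matrix (Fin n) (Fin n) ℂ)ᴴ *ᵥ w)
    (stdGaussianVec (Fin n)) (stdGaussianVec (Fin n)) :=
  ⟨(Continuous.matrix_mulVec continuous_const continuous_id).measurable,
    map_unitary_stdGaussianVec _ (Unitary.star_mem hH.eigenvectorUnitary.2)⟩

lemma quadForm_pos_ae (hH : H.PosSemidef) (hT : 0 < H.trace.re) :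
    ∀ᵐ w ∂(stdGaussianVec (Fin n)), 0 < quadForm H (WithLp.toLp 2 w) := by
  obtain ⟨i, hi⟩ := exists_pos_of_sum_pos (hT.trans_eq (trace_re_eq_sum_eigenvalues hH.1))
  filter_upwards [(measurePreserving_eigenvectorUnitary hH.1).quasiMeasurePreserving.ae
    (weightedNormSq_pos_ae hH.eigenvalues_nonneg hi)] with w hw
  rwa [quadForm_eq_sum_eigenvalues hH.1]

lemma integrable_log_quadForm (hH : H.PosSemidef) (hT : 0 < H.trace.re) :
    Integrable (fun w => Real.log (quadForm H (WithLp.toLp 2 w))) (stdGaussianVec (Fin n)) := by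
  obtain ⟨i, hi⟩ := exists_pos_of_sum_pos (hT.trans_eq (trace_re_eq_sum_eigenvalues hH.1))
  simp only [quadForm_eq_sum_eigenvalues hH.1]
  exact (measurePreserving_eigenvectorUnitary hH.1).integrable_comp_of_integrable
    (integrable_log_weightedNormSq hH.eigenvalues_nonneg hi)

lemma integral_log_quadForm (hH : H.PosSemidef) :
    ∫ w, Real.log (quadForm H (WithLp.toLp 2 w)) ∂(stdGaussianVec (Fin n))
      = ∫ w, Real.log (∑ j, hH.1.eigenvalues j * Complex.normSq (w j))
          ∂(stdGaussianVec (Fin n)) := by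
  have hm := measurePreserving_eigenvectorUnitary hH.1
  have h := integral_map (μ := stdGaussianVec (Fin n)) hm.measurable.aemeasurable
    (f := fun w => Real.log (∑ j, hH.1.eigenvalues j * Complex.normSq (w j)))
    (Real.measurable_log.comp (measurable_weightedNormSq _)).aestronglyMeasurable
  rw [hm.map_eq] at h
  rw [h]
  simp only [quadForm_eq_sum_eigenvalues hH.1]

lemma log_trace_sub_le_integral_log_quadForm (hH : H.PosSemidef) (hT : 0 < H.trace.re) :
    Real.log H.trace.re - Real.eulerMascheroniConstant
      ≤ ∫ w, Real.log (quadForm H (WithLp.toLp 2 w)) ∂(stdGaussianVec (Fin n)) := by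
  rw [integral_log_quadForm hH, trace_re_eq_sum_eigenvalues hH.1]
  rw [trace_re_eq_sum_eigenvalues hH.1] at hT
  exact log_sum_sub_le_integral_log hH.eigenvalues_nonneg hT

lemma exists_quadForm_le_eigenvalue (hH : H.IsHermitian) {v : Vec n} (hv : ‖v‖ = 1) :
    ∃ i, quadForm H v ≤ hH.eigenvalues i := by
  by_contra! hcon
  set u := (hH.eigenvectorUnitary : Matrix (Fin n) (Fin n) ℂ)ᴴ *ᵥ v.ofLp with hu
  have h1 : ∑ j, Complex.normSq (u j) = 1 := by
    have h2 : quadForm 1 (WithLp.toLp 2 u) = quadForm 1 v := by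
      rw [hu, quadForm_conj, Matrix.conjTranspose_conjTranspose, Matrix.mul_one]
      congr 1
      exact Matrix.mem_unitaryGroup_iff.1 hH.eigenvectorUnitary.2
    rw [quadForm_one, quadForm_one, hv, EuclideanSpace.norm_sq_eq] at h2
    simpa [Complex.normSq_eq_norm_sq] using h2
  have h3 : quadForm H v = ∑ j, hH.eigenvalues j * Complex.normSq (u j) :=
    quadForm_eq_sum_eigenvalues hH v.ofLp
  have h4 : ∑ j, hH.eigenvalues j * Complex.normSq (u j)
      < ∑ j, quadForm H v * Complex.normSq (u j) := by
    obtain ⟨i, hi⟩ := exists_pos_of_sum_pos (h1.symm ▸ one_pos)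
    refine Finset.sum_lt_sum (fun j _ => ?_) ⟨i, Finset.mem_univ i, ?_⟩
    · exact mul_le_mul_of_nonneg_right (hcon j).le (Complex.normSq_nonneg _)
    · exact mul_lt_mul_of_pos_right (hcon i) hi
  rw [← h3, ← Finset.mul_sum, h1, mul_one] at h4
  exact lt_irrefl _ h4

lemma integral_log_quadForm_le (hH : H.PosSemidef) (hT : 0 < H.trace.re) {k : ℕ} (hk : 1 ≤ k)
    {v : Vec n} (hv : ‖v‖ = 1) (hle : (k : ℝ) / (k + n - 1) * H.trace.re ≤ quadForm H v) :
    ∫ w, Real.log (quadForm H (WithLp.toLp 2 w)) ∂(stdGaussianVec (Fin n))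
      ≤ Real.log H.trace.re + Cconst n k - Real.eulerMascheroniConstant := by
  obtain ⟨i, hi⟩ := exists_quadForm_le_eigenvalue hH.1 hv
  rw [integral_log_quadForm hH]
  rw [trace_re_eq_sum_eigenvalues hH.1] at hT hle ⊢
  have h := integral_log_le_Cconst hH.eigenvalues_nonneg hT hk (i := i)
  rw [Fintype.card_fin] at h
  exact h (hle.trans hi)

end

/-! ### A direction of large moment -/

/-- The even and odd parts of `(A + B) ^ (m + 2)` in `B`, bounded below by their lowest terms. The
two bounds are proved together, since each step of the induction for one uses the other. -/
lemma two_mul_pow_add_le_add_pow_add_sub_pow {A : ℝ} (hA : 0 ≤ A) (B : ℝ) (m : ℕ) :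
    2 * A ^ (m + 2) + (m + 2) * (m + 1) * (A ^ m * B ^ 2) ≤ (A + B) ^ (m + 2) + (A - B) ^ (m + 2) ∧
    2 * (m + 2) * (A ^ (m + 1) * B ^ 2) ≤ B * ((A + B) ^ (m + 2) - (A - B) ^ (m + 2)) := by
  induction m with
  | zero => constructor <;> (apply le_of_eq; push_cast; ring)
  | succ m ih =>
    obtain ⟨h1, h2⟩ := ih
    have h1' := mul_le_mul_of_nonneg_left h1 hA
    have h2' := mul_le_mul_of_nonneg_left h2 hA
    have h3 := mul_le_mul_of_nonneg_left h1 (sq_nonneg B)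
    have h4 : 0 ≤ B ^ 2 * ((m + 2) * (m + 1) * (A ^ m * B ^ 2)) := by positivity
    push_cast
    constructor
    · calc _ = A * (2 * A ^ (m + 2) + (m + 2) * (m + 1) * (A ^ m * B ^ 2))
            + 2 * (m + 2) * (A ^ (m + 1) * B ^ 2) := by ring
        _ ≤ _ := add_le_add h1' h2
        _ = _ := by ring
    · calc _ ≤ A * (2 * (m + 2) * (A ^ (m + 1) * B ^ 2))
            + B ^ 2 * (2 * A ^ (m + 2) + (m + 2) * (m + 1) * (A ^ m * B ^ 2)) := by
            refine le_trans (le_add_of_nonneg_right h4) (le_of_eq ?_)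
            ring
        _ ≤ _ := add_le_add h2' h3
        _ = _ := by ring

lemma pow_add_mul_le_add_pow {P Q : ℝ} (hP : 0 ≤ P) (hQ : 0 ≤ Q) (m : ℕ) :
    P ^ (m + 1) + (m + 1) * (P ^ m * Q) ≤ (P + Q) ^ (m + 1) := by
  induction m with
  | zero => simp
  | succ m ih =>
    have h := mul_le_mul_of_nonneg_right ih (add_nonneg hP hQ)
    have h4 : 0 ≤ (m + 1) * (P ^ m * Q) * Q := by positivity
    push_cast
    calc _ ≤ (P ^ (m + 1) + (m + 1) * (P ^ m * Q)) * (P + Q) := by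
          refine le_trans (le_add_of_nonneg_right h4) (le_of_eq ?_)
          ring
      _ ≤ _ := h
      _ = _ := by ring

/-- The second-order expansion of `|a + ω t b|^{2k}`, averaged over the fourth roots of unity `ω`.
The averaging removes the terms that depend on the phase of `a b̄`. -/
lemma le_sum_four_phases (a b : ℂ) (t : ℝ) (m : ℕ) :
    4 * Complex.normSq a ^ (m + 1)
        + 4 * (m + 1) ^ 2 * (t ^ 2 * (Complex.normSq a ^ m * Complex.normSq b))
      ≤ Complex.normSq (a + t * b) ^ (m + 1) + Complex.normSq (a - t * b) ^ (m + 1)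
        + Complex.normSq (a + t * (Complex.I * b)) ^ (m + 1)
        + Complex.normSq (a - t * (Complex.I * b)) ^ (m + 1) := by
  set P := Complex.normSq a with hP
  set Q := t ^ 2 * Complex.normSq b with hQ
  set B := 2 * t * (a.re * b.re + a.im * b.im) with hB
  set B' := 2 * t * (a.im * b.re - a.re * b.im) with hB'
  have e1 : Complex.normSq (a + t * b) = P + Q + B := by
    simp [hP, hQ, hB, Complex.normSq_apply]; ring
  have e2 : Complex.normSq (a - t * b) = P + Q - B := by
    simp [hP, hQ, hB, Complex.normSq_apply]; ring
  have e3 : Complex.normSq (a + t * (Complex.I * b)) = P + Q + B' := by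
    simp [hP, hQ, hB', Complex.normSq_apply]; ring
  have e4 : Complex.normSq (a - t * (Complex.I * b)) = P + Q - B' := by
    simp [hP, hQ, hB', Complex.normSq_apply]; ring
  have hBB : B ^ 2 + B' ^ 2 = 4 * (P * Q) := by
    simp only [hP, hQ, hB, hB', Complex.normSq_apply]; ring
  have hP0 : 0 ≤ P := Complex.normSq_nonneg _
  have hQ0 : 0 ≤ Q := mul_nonneg (sq_nonneg _) (Complex.normSq_nonneg _)
  rw [e1, e2, e3, e4, show t ^ 2 * (P ^ m * Complex.normSq b) = P ^ m * Q by rw [hQ]; ring]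
  clear_value P Q B B'
  rcases m with _ | m
  · apply le_of_eq; push_cast; ring
  · have h1 := (two_mul_pow_add_le_add_pow_add_sub_pow (add_nonneg hP0 hQ0) B m).1
    have h2 := (two_mul_pow_add_le_add_pow_add_sub_pow (add_nonneg hP0 hQ0) B' m).1
    have h3 := pow_add_mul_le_add_pow hP0 hQ0 (m + 1)
    have h4 : P ^ m ≤ (P + Q) ^ m := pow_le_pow_left₀ hP0 (le_add_of_nonneg_right hQ0) m
    have h5 : 0 ≤ 4 * ((m + 2 : ℝ) * (m + 1)) * (P * Q) := by positivity
    have h6 := mul_le_mul_of_nonneg_left h4 h5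
    have h7 : (m + 2 : ℝ) * (m + 1) * ((P + Q) ^ m * B ^ 2)
        + (m + 2) * (m + 1) * ((P + Q) ^ m * B' ^ 2)
        = 4 * ((m + 2 : ℝ) * (m + 1)) * (P * Q) * (P + Q) ^ m := by
      rw [← mul_add, ← mul_add, hBB]; ring
    push_cast at h3 ⊢
    calc _ = 4 * (P ^ (m + 1 + 1) + (m + 1 + 1) * (P ^ (m + 1) * Q))
          + 4 * ((m + 2 : ℝ) * (m + 1)) * (P * Q) * P ^ m := by ring
      _ ≤ 4 * (P + Q) ^ (m + 1 + 1)
          + 4 * ((m + 2 : ℝ) * (m + 1)) * (P * Q) * (P + Q) ^ m :=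
          add_le_add (mul_le_mul_of_nonneg_left h3 (by norm_num)) h6
      _ ≤ _ := by rw [← h7]; linarith

/-- The moment `∫ |⟨v, x⟩|^{2k} dμ(x)`. -/
noncomputable def dirMoment {n : ℕ} (μ : Measure (Vec n)) (k : ℕ) (v : Vec n) : ℝ :=
  ∫ x, (‖inner ℂ v x‖ ^ 2) ^ k ∂μ

lemma dirMoment_le {n : ℕ} {μ : Measure (Vec n)} {k : ℕ} {v : Vec n}
    (hmax : ∀ w ∈ Metric.sphere (0 : Vec n) 1, dirMoment μ k w ≤ dirMoment μ k v) {w : Vec n}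
    (hw : w ≠ 0) : dirMoment μ k w ≤ (‖w‖ ^ 2) ^ k * dirMoment μ k v := by
  have hn : ‖w‖ ≠ 0 := norm_ne_zero_iff.2 hw
  have h := hmax (((‖w‖⁻¹ : ℝ) : ℂ) • w) (by simp [norm_smul, hn])
  have h2 : dirMoment μ k (((‖w‖⁻¹ : ℝ) : ℂ) • w) = ((‖w‖ ^ 2) ^ k)⁻¹ * dirMoment μ k w := by
    rw [dirMoment, dirMoment, ← integral_const_mul]
    refine integral_congr_ae (ae_of_all _ fun x => ?_)
    simp only [inner_smul_left, norm_mul, mul_pow]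
    simp
  rw [h2, inv_mul_le_iff₀ (by positivity)] at h
  exact h

section
variable {n : ℕ} {μ : Measure (Vec n)} [IsProbabilityMeasure μ]

lemma integrable_of_continuous_of_sphere (hμ : ∀ᵐ x ∂μ, ‖x‖ = 1) {f : Vec n → ℝ}
    (hf : Continuous f) : Integrable f μ := by
  obtain ⟨C, hC⟩ := (isCompact_sphere (0 : Vec n) 1).exists_bound_of_continuousOn hf.continuousOn
  exact Integrable.of_bound hf.measurable.aestronglyMeasurable C
    (hμ.mono fun x hx => hC x (by simpa using hx))

lemma continuousOn_dirMoment (hμ : ∀ᵐ x ∂μ, ‖x‖ = 1) (k : ℕ) :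
    ContinuousOn (dirMoment μ k) (Metric.sphere 0 1) := by
  refine continuousOn_of_dominated (bound := fun _ => 1) (fun v _ => ?_) (fun v hv => ?_)
    (integrable_const _) (ae_of_all _ fun x => by fun_prop)
  · exact Continuous.aestronglyMeasurable (by fun_prop)
  · filter_upwards [hμ] with x hx
    have hv' : ‖v‖ = 1 := by simpa using hv
    have h := norm_inner_le_norm (𝕜 := ℂ) v x
    rw [hv', hx, one_mul] at h
    rw [Real.norm_of_nonneg (by positivity), ← pow_mul]
    exact pow_le_one₀ (norm_nonneg _) h

lemma exists_isMax_dirMoment (hn : 1 ≤ n) (hμ : ∀ᵐ x ∂μ, ‖x‖ = 1) {k : ℕ} (hk : 1 ≤ k) :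
    ∃ v : Vec n, ‖v‖ = 1 ∧ 0 < dirMoment μ k v ∧
      ∀ w ∈ Metric.sphere (0 : Vec n) 1, dirMoment μ k w ≤ dirMoment μ k v := by
  have hne : (Metric.sphere (0 : Vec n) 1).Nonempty :=
    ⟨EuclideanSpace.single ⟨0, hn⟩ 1, by simp⟩
  obtain ⟨v, hv, hmax⟩ := (isCompact_sphere (0 : Vec n) 1).exists_isMaxOn hne
    (continuousOn_dirMoment hμ k)
  have hnonneg : ∀ w, 0 ≤ dirMoment μ k w := fun w =>
    integral_nonneg fun x => by positivity
  refine ⟨v, by simpa using hv, lt_of_le_of_ne (hnonneg v) fun h0 => ?_, hmax⟩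
  -- if the maximum were zero, every coordinate of `x` would vanish almost surely
  have hz : ∀ j : Fin n, ∀ᵐ x ∂μ, x j = 0 := by
    intro j
    have h1 : dirMoment μ k (EuclideanSpace.single j 1) = 0 :=
      le_antisymm (h0 ▸ hmax (by simp)) (hnonneg _)
    rw [dirMoment, integral_eq_zero_iff_of_nonneg (fun x => by positivity)
      (integrable_of_continuous_of_sphere hμ (by fun_prop))] at h1
    filter_upwards [h1] with x hx
    have hx' : (‖inner ℂ (EuclideanSpace.single j (1 : ℂ)) x‖ ^ 2) ^ k = 0 := hx
    simpa [EuclideanSpace.inner_single_left, Nat.one_le_iff_ne_zero.1 hk] using hx'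
  have hfalse : ∀ᵐ x ∂μ, False := by
    filter_upwards [hμ, ae_all_iff.2 hz] with x hx hx0
    have : x = 0 := by ext j; exact hx0 j
    simp [this] at hx
  exact IsProbabilityMeasure.ne_zero μ (by simpa using hfalse)

/-- The second-order optimality condition at a maximiser `v` of the moment, in a direction `u`
orthogonal to `v`. -/
lemma second_order_condition (hμ : ∀ᵐ x ∂μ, ‖x‖ = 1) {m : ℕ} {v u : Vec n} (hv : ‖v‖ = 1)
    (hu : ‖u‖ = 1) (huv : inner ℂ v u = 0)
    (hmax : ∀ w ∈ Metric.sphere (0 : Vec n) 1, dirMoment μ (m + 1) w ≤ dirMoment μ (m + 1) v) :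
    (m + 1) * ∫ x, (‖inner ℂ v x‖ ^ 2) ^ m * ‖inner ℂ u x‖ ^ 2 ∂μ ≤ dirMoment μ (m + 1) v := by
  set F := dirMoment μ (m + 1) v with hF
  set G := ∫ x, (‖inner ℂ v x‖ ^ 2) ^ m * ‖inner ℂ u x‖ ^ 2 ∂μ with hG
  have hω : ∀ (t : ℝ) (c : ℂ), ‖c‖ = 1 → dirMoment μ (m + 1) (v + ((t : ℂ) * c) • u)
      ≤ (1 + t ^ 2) ^ (m + 1) * F := by
    intro t c hc
    have hnorm : ‖v + ((t : ℂ) * c) • u‖ ^ 2 = 1 + t ^ 2 := by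
      have h := norm_add_sq_eq_norm_sq_add_norm_sq_of_inner_eq_zero (𝕜 := ℂ) v
        (((t : ℂ) * c) • u) (by rw [inner_smul_right, huv, mul_zero])
      rw [sq, h, hv, norm_smul, hu, norm_mul, hc, Complex.norm_real, Real.norm_eq_abs, mul_one,
        mul_one, mul_one, abs_mul_abs_self]
      ring
    have hne : v + ((t : ℂ) * c) • u ≠ 0 := by
      intro h0
      rw [h0] at hnorm
      simp at hnorm
      nlinarith [sq_nonneg t]
    have h := dirMoment_le hmax hne
    rwa [hnorm] at h
  have hint : ∀ w : Vec n, Integrable (fun x => (‖inner ℂ w x‖ ^ 2) ^ (m + 1)) μ := fun w =>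
    integrable_of_continuous_of_sphere hμ (by fun_prop)
  have hint2 : ∀ w w' : Vec n, Integrable (fun x =>
      (‖inner ℂ w x‖ ^ 2) ^ (m + 1) + (‖inner ℂ w' x‖ ^ 2) ^ (m + 1)) μ := fun w w' =>
    (hint w).add (hint w')
  have hint3 : ∀ w w' w'' : Vec n, Integrable (fun x => (‖inner ℂ w x‖ ^ 2) ^ (m + 1)
      + (‖inner ℂ w' x‖ ^ 2) ^ (m + 1) + (‖inner ℂ w'' x‖ ^ 2) ^ (m + 1)) μ := fun w w' w'' =>
    (hint2 w w').add (hint w'')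
  have hintG : Integrable (fun x => (‖inner ℂ v x‖ ^ 2) ^ m * ‖inner ℂ u x‖ ^ 2) μ :=
    integrable_of_continuous_of_sphere hμ (by fun_prop)
  have hexp : ∀ s : ℝ, 0 < s → (m + 1) ^ 2 * G ≤ s⁻¹ * ((1 + s) ^ (m + 1) - 1) * F := by
    intro s hs
    set t := Real.sqrt s with ht
    have hts : t ^ 2 = s := Real.sq_sqrt hs.le
    have h4 : 4 * F + 4 * (m + 1) ^ 2 * (s * G)
        ≤ dirMoment μ (m + 1) (v + ((t : ℂ) * 1) • u)
          + dirMoment μ (m + 1) (v + ((t : ℂ) * (-1)) • u)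
          + dirMoment μ (m + 1) (v + ((t : ℂ) * (-Complex.I)) • u)
          + dirMoment μ (m + 1) (v + ((t : ℂ) * Complex.I) • u) := by
      rw [hF, hG]
      simp only [dirMoment]
      rw [← integral_add (hint _) (hint _), ← integral_add (hint2 _ _) (hint _),
        ← integral_add (hint3 _ _ _) (hint _), ← integral_const_mul,
        ← integral_const_mul, ← integral_const_mul,
        ← integral_add ((hint _).const_mul _) ((hintG.const_mul _).const_mul _)]
      refine integral_mono (((hint _).const_mul _).add ((hintG.const_mul _).const_mul _))
        ((hint3 _ _ _).add (hint _)) fun x => ?_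
      have h := le_sum_four_phases (inner ℂ v x) (inner ℂ u x) t m
      rw [hts] at h
      simp only [Complex.normSq_eq_norm_sq] at h
      refine h.trans (le_of_eq ?_)
      simp only [inner_add_left, inner_smul_left, map_mul, Complex.conj_ofReal, map_one, map_neg,
        Complex.conj_I, neg_neg]
      ring_nf
    have h5 := add_le_add (add_le_add (add_le_add (hω t 1 (by simp)) (hω t (-1) (by simp)))
      (hω t (-Complex.I) (by simp))) (hω t Complex.I (by simp))
    rw [hts] at h5
    rw [mul_assoc, le_inv_mul_iff₀ hs]
    nlinarith [h4.trans h5]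
  have hlim : Tendsto (fun s : ℝ => s⁻¹ * ((1 + s) ^ (m + 1) - 1) * F) (𝓝[>] 0)
      (𝓝 ((m + 1) * F)) := by
    have hd : HasDerivAt (fun s : ℝ => (1 + s) ^ (m + 1)) (m + 1) 0 := by
      have h := ((hasDerivAt_id (0 : ℝ)).const_add 1).fun_pow (m + 1)
      simpa using h
    have h := hd.tendsto_slope_zero_right
    simpa using h.mul_const F
  have hfin : (m + 1 : ℝ) ^ 2 * G ≤ (m + 1) * F :=
    ge_of_tendsto hlim (eventually_mem_nhdsWithin.mono fun s hs => hexp s hs)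
  have hm : (0 : ℝ) < m + 1 := by positivity
  rw [sq, mul_assoc] at hfin
  exact le_of_mul_le_mul_left hfin hm

/-- Some unit vector `v` is an approximate top eigenvector of `∫ |⟨v, x⟩|^{2k-2} x x† dμ(x)`, up to
the factor `k / (k + n - 1)`. A maximiser of the `2k`-th moment has this property. -/
lemma exists_direction (hn : 1 ≤ n) (hμ : ∀ᵐ x ∂μ, ‖x‖ = 1) {k : ℕ} (hk : 1 ≤ k) :
    ∃ v : Vec n, ‖v‖ = 1 ∧ 0 < dirMoment μ k v ∧
      (k : ℝ) / (k + n - 1) * dirMoment μ (k - 1) v ≤ dirMoment μ k v := by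
  obtain ⟨v, hv, hpos, hmax⟩ := exists_isMax_dirMoment hn hμ hk
  refine ⟨v, hv, hpos, ?_⟩
  obtain ⟨m, rfl⟩ : ∃ m, k = m + 1 := ⟨k - 1, by omega⟩
  obtain ⟨p, rfl⟩ : ∃ p, n = p + 1 := ⟨n - 1, by omega⟩
  obtain ⟨b, hb⟩ := Orthonormal.exists_orthonormalBasis_extension_of_card_eq (𝕜 := ℂ)
    (ι := Fin (p + 1)) (E := Vec (p + 1)) (by simp) (v := fun _ => v) (s := {0})
    (by
      rw [orthonormal_iff_ite]
      rintro ⟨i, rfl⟩ ⟨j, rfl⟩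
      simp [hv])
  have hb0 : b 0 = v := hb 0 rfl
  have hintG : ∀ u : Vec (p + 1),
      Integrable (fun x => (‖inner ℂ v x‖ ^ 2) ^ m * ‖inner ℂ u x‖ ^ 2) μ := fun u =>
    integrable_of_continuous_of_sphere hμ (by fun_prop)
  have hT : dirMoment μ m v
      = ∑ i, ∫ x, (‖inner ℂ v x‖ ^ 2) ^ m * ‖inner ℂ (b i) x‖ ^ 2 ∂μ := by
    rw [← integral_finsetSum _ fun i _ => hintG (b i), dirMoment]
    refine integral_congr_ae (hμ.mono fun x hx => ?_)
    simp only
    rw [← Finset.mul_sum, b.sum_sq_norm_inner_right, hx, one_pow, mul_one]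
  have h0 : ∫ x, (‖inner ℂ v x‖ ^ 2) ^ m * ‖inner ℂ (b 0) x‖ ^ 2 ∂μ = dirMoment μ (m + 1) v := by
    rw [hb0, dirMoment]
    simp only [pow_succ (_ ^ 2)]
  have hi : ∀ i : Fin p, (m + 1) * ∫ x, (‖inner ℂ v x‖ ^ 2) ^ m * ‖inner ℂ (b i.succ) x‖ ^ 2 ∂μ
      ≤ dirMoment μ (m + 1) v := fun i =>
    second_order_condition hμ hv (b.orthonormal.1 _)
      (by rw [← hb0]; exact b.orthonormal.2 (Fin.succ_ne_zero i).symm) hmax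
  rw [Fin.sum_univ_succ, h0] at hT
  have hsum := Finset.sum_le_sum fun i (_ : i ∈ Finset.univ) => hi i
  rw [← Finset.mul_sum, Finset.sum_const, Finset.card_univ, Fintype.card_fin, nsmul_eq_mul] at hsum
  rw [Nat.add_sub_cancel, hT]
  push_cast
  rw [div_mul_eq_mul_div, add_sub_assoc, add_sub_cancel_right,
    div_le_iff₀ (by positivity)]
  linarith

end

/-! ### The moment matrix -/

section
variable {n : ℕ}

lemma isHomogeneous_rePoly (a b : Fin n) : (rePoly a b).IsHomogeneous 2 :=
  ((MvPolynomial.isHomogeneous_X ℝ _).mul (MvPolynomial.isHomogeneous_X ℝ _)).add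
    ((MvPolynomial.isHomogeneous_X ℝ _).mul (MvPolynomial.isHomogeneous_X ℝ _))

lemma isHomogeneous_imPoly (a b : Fin n) : (imPoly a b).IsHomogeneous 2 :=
  ((MvPolynomial.isHomogeneous_X ℝ _).mul (MvPolynomial.isHomogeneous_X ℝ _)).sub
    ((MvPolynomial.isHomogeneous_X ℝ _).mul (MvPolynomial.isHomogeneous_X ℝ _))

lemma isHomogeneous_quadPoly (A : Matrix (Fin n) (Fin n) ℂ) : (quadPoly A).IsHomogeneous 2 :=
  MvPolynomial.IsHomogeneous.sum _ _ _ fun a _ => MvPolynomial.IsHomogeneous.sum _ _ _ fun b _ =>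
    ((isHomogeneous_rePoly b a).C_mul _).sub ((isHomogeneous_imPoly b a).C_mul _)

lemma isHomogeneous_overlapPoly_pow_mul_quadPoly {k : ℕ} (hk : 1 ≤ k) (v : Vec n)
    (A : Matrix (Fin n) (Fin n) ℂ) :
    (overlapPoly v ^ (k - 1) * quadPoly A).IsHomogeneous (2 * k) := by
  have h := ((isHomogeneous_quadPoly (Matrix.vecMulVec v.ofLp (star v.ofLp))).pow (k - 1)).mul
    (isHomogeneous_quadPoly A)
  rwa [show 2 * (k - 1) + 2 = 2 * k by omega] at h

/-- Contracting the moment matrix with `A` gives the functional on `|⟨v, x⟩|^{2k-2} ⟨x, A x⟩`. -/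
lemma trace_mul_momentMatrix_re (k : ℕ) (L : RealPoly n →ₗ[ℝ] ℝ) (v : Vec n)
    (A : Matrix (Fin n) (Fin n) ℂ) :
    (A * momentMatrix k L v).trace.re = L (overlapPoly v ^ (k - 1) * quadPoly A) := by
  simp only [Matrix.trace, Matrix.diag, Matrix.mul_apply, Complex.re_sum, quadPoly,
    Finset.mul_sum, map_sum, mul_sub, map_sub]
  refine Finset.sum_congr rfl fun a _ => Finset.sum_congr rfl fun b _ => ?_
  simp only [← MvPolynomial.smul_eq_C_mul, mul_smul_comm, map_smul,
    smul_eq_mul, momentMatrix, Complex.mul_re]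

lemma isHermitian_momentMatrix (k : ℕ) (L : RealPoly n →ₗ[ℝ] ℝ) (v : Vec n) :
    (momentMatrix k L v).IsHermitian := by
  ext a b
  have h1 : (rePoly b a : RealPoly n) = rePoly a b := by simp only [rePoly]; ring
  have h2 : (imPoly b a : RealPoly n) = -imPoly a b := by simp only [imPoly]; ring
  simp only [Matrix.conjTranspose_apply, momentMatrix]
  rw [h1, h2, mul_neg, map_neg]
  apply Complex.ext <;> simp

lemma continuous_quadForm (A : Matrix (Fin n) (Fin n) ℂ) : Continuous (quadForm A) := by
  unfold quadForm
  simp only [dotProduct, Matrix.mulVec]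
  fun_prop

lemma quadForm_vecMulVec (v x : Vec n) :
    quadForm (Matrix.vecMulVec v.ofLp (star v.ofLp)) x = ‖inner ℂ v x‖ ^ 2 := by
  rw [← eval_overlapPoly, overlapPoly, eval_quadPoly]

section
variable {k d : ℕ} {A : Fin d → Matrix (Fin n) (Fin n) ℂ} {L : RealPoly n →ₗ[ℝ] ℝ}
  {μ : Measure (Vec n)}

lemma trace_mul_momentMatrix_eq_integral (hk : 1 ≤ k)
    (hL : ∀ f : RealPoly n, f.IsHomogeneous (2 * k) →
      L f = ∫ x, MvPolynomial.eval (realCoords x) f ∂μ) (v : Vec n)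
    (B : Matrix (Fin n) (Fin n) ℂ) :
    (B * momentMatrix k L v).trace.re
      = ∫ x, (‖inner ℂ v x‖ ^ 2) ^ (k - 1) * quadForm B x ∂μ := by
  rw [trace_mul_momentMatrix_re, hL _ (isHomogeneous_overlapPoly_pow_mul_quadPoly hk v B)]
  simp only [map_mul, map_pow, eval_overlapPoly, eval_quadPoly]

lemma quadForm_momentMatrix (hk : 1 ≤ k)
    (hL : ∀ f : RealPoly n, f.IsHomogeneous (2 * k) →
      L f = ∫ x, MvPolynomial.eval (realCoords x) f ∂μ) (v u : Vec n) :
    quadForm (momentMatrix k L v) u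
      = ∫ x, (‖inner ℂ v x‖ ^ 2) ^ (k - 1) * ‖inner ℂ u x‖ ^ 2 ∂μ := by
  have h := trace_mul_momentMatrix_eq_integral hk hL v (Matrix.vecMulVec u.ofLp (star u.ofLp))
  simp only [quadForm_vecMulVec] at h
  rw [← h, quadForm, Matrix.vecMulVec_mul, Matrix.trace_vecMulVec,
    Matrix.dotProduct_mulVec, dotProduct_comm]

lemma posSemidef_momentMatrix (hk : 1 ≤ k)
    (hL : ∀ f : RealPoly n, f.IsHomogeneous (2 * k) →
      L f = ∫ x, MvPolynomial.eval (realCoords x) f ∂μ) (v : Vec n) :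
    (momentMatrix k L v).PosSemidef := by
  have hH := isHermitian_momentMatrix k L v
  refine Matrix.PosSemidef.of_dotProduct_mulVec_nonneg hH fun u => ?_
  rw [Complex.le_def]
  refine ⟨?_, (hH.im_star_dotProduct_mulVec_self u).symm⟩
  have h := quadForm_momentMatrix hk hL v (WithLp.toLp 2 u)
  exact (integral_nonneg fun x => by positivity).trans_eq h.symm

/-! ### The averaged objective -/

/-- Jensen's inequality for the logarithm under the weight `|⟨v, x⟩|^{2k-2}`: averaging the matrices
`x x†` over optimal solutions does not lower the mean logarithm of the values `⟨x, Aᵢ x⟩`. -/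
lemma mul_log_opt_le [IsProbabilityMeasure μ] (hd : 1 ≤ d) (hA : ∀ i, (A i).PosSemidef)
    (hμ : ∀ᵐ x ∂μ, ‖x‖ = 1) (hopt : ∀ᵐ x ∂μ, geomMean A x = opt A) (hpos : 0 < opt A)
    {ρ : Vec n → ℝ} (hρ : Continuous ρ) (hρ0 : ∀ x, 0 ≤ ρ x) (hW : 0 < ∫ x, ρ x ∂μ) :
    (∀ i, 0 < ∫ x, ρ x * quadForm (A i) x ∂μ) ∧
    d * Real.log (opt A)
      ≤ ∑ i, (Real.log (∫ x, ρ x * quadForm (A i) x ∂μ) - Real.log (∫ x, ρ x ∂μ)) := by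
  have hd0 : (0 : ℝ) < d := by exact_mod_cast hd
  set W := ∫ x, ρ x ∂μ with hWdef
  have hint : ∀ i, Integrable (fun x => ρ x * quadForm (A i) x) μ := fun i =>
    integrable_of_continuous_of_sphere hμ (hρ.mul (continuous_quadForm _))
  have hintρ : Integrable ρ μ := integrable_of_continuous_of_sphere hμ hρ
  have hq : ∀ᵐ x ∂μ, ∀ i, 0 < quadForm (A i) x := by
    filter_upwards [hopt] with x hx i
    refine lt_of_le_of_ne (quadForm_nonneg (hA i) x) fun h0 => hpos.ne ?_
    rw [← hx, geomMean, Finset.prod_eq_zero (Finset.mem_univ i) h0.symm,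
      Real.zero_rpow (by positivity)]
  have hc : ∀ i, 0 < ∫ x, ρ x * quadForm (A i) x ∂μ := by
    intro i
    have hnn : ∀ x, 0 ≤ ρ x * quadForm (A i) x := fun x =>
      mul_nonneg (hρ0 x) (quadForm_nonneg (hA i) x)
    refine lt_of_le_of_ne (integral_nonneg hnn) fun h0 => hW.ne ?_
    have h1 := (integral_eq_zero_iff_of_nonneg hnn (hint i)).1 h0.symm
    rw [hWdef, eq_comm]
    refine integral_eq_zero_of_ae ?_
    filter_upwards [h1, hq] with x hx hqx
    exact (mul_eq_zero.1 hx).resolve_right (hqx i).ne'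
  refine ⟨hc, ?_⟩
  set c : Fin d → ℝ := fun i => (∫ x, ρ x * quadForm (A i) x ∂μ) / W with hcdef
  have hc0 : ∀ i, 0 < c i := fun i => div_pos (hc i) hW
  -- tangent line bound `log q ≤ log c + q / c - 1` at the mean `c` of `q`
  have hpt : ∀ᵐ x ∂μ, ρ x * (d * Real.log (opt A))
      ≤ ∑ i, (ρ x * (Real.log (c i) - 1) + (c i)⁻¹ * (ρ x * quadForm (A i) x)) := by
    filter_upwards [hopt, hq] with x hx hqx
    have h1 : d * Real.log (opt A) = ∑ i, Real.log (quadForm (A i) x) := by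
      rw [← hx, geomMean, Real.log_rpow (Finset.prod_pos fun i _ => hqx i),
        Real.log_prod fun i _ => (hqx i).ne']
      field_simp
    rw [h1, Finset.mul_sum]
    refine Finset.sum_le_sum fun i _ => ?_
    have h2 := Real.log_le_sub_one_of_pos (div_pos (hqx i) (hc0 i))
    rw [Real.log_div (hqx i).ne' (hc0 i).ne'] at h2
    have h3 : Real.log (quadForm (A i) x)
        ≤ Real.log (c i) - 1 + (c i)⁻¹ * quadForm (A i) x := by
      rw [inv_mul_eq_div]; linarith
    refine (mul_le_mul_of_nonneg_left h3 (hρ0 x)).trans (le_of_eq (by ring))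
  have hterm : ∀ i, Integrable (fun x => ρ x * (Real.log (c i) - 1)
      + (c i)⁻¹ * (ρ x * quadForm (A i) x)) μ := fun i =>
    (hintρ.mul_const _).add ((hint i).const_mul _)
  have h := integral_mono_ae (hintρ.mul_const _) (integrable_finsetSum _ fun i _ => hterm i) hpt
  rw [integral_mul_const, integral_finsetSum _ fun i _ => hterm i, ← hWdef] at h
  have hval : ∀ i, ∫ x, (ρ x * (Real.log (c i) - 1) + (c i)⁻¹ * (ρ x * quadForm (A i) x)) ∂μ
      = W * Real.log (c i) := by
    intro i
    rw [integral_add (hintρ.mul_const _) ((hint i).const_mul _), integral_mul_const,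
      integral_const_mul, ← hWdef]
    have : (c i)⁻¹ * ∫ x, ρ x * quadForm (A i) x ∂μ = W := by
      rw [hcdef]
      have := (hc i).ne'
      field_simp
    rw [this]
    ring
  simp only [hval] at h
  rw [← Finset.mul_sum] at h
  refine (le_of_mul_le_mul_left h hW).trans (le_of_eq ?_)
  exact Finset.sum_congr rfl fun i _ => Real.log_div (hc i).ne' hW.ne'

end

/-! ### Analysis of the rounding -/

/-- Jensen's inequality for the exponential function. -/
lemma exp_integral_log_le {Ω : Type*} [MeasurableSpace Ω] {P : Measure Ω}
    [IsProbabilityMeasure P] {g : Ω → ℝ} (hpos : ∀ᵐ w ∂P, 0 < g w) (hg : Integrable g P)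
    (hlog : Integrable (fun w => Real.log (g w)) P) :
    Real.exp (∫ w, Real.log (g w) ∂P) ≤ ∫ w, g w ∂P := by
  set c := ∫ w, Real.log (g w) ∂P with hc
  have h : ∫ w, Real.exp c * (1 - c + Real.log (g w)) ∂P ≤ ∫ w, g w ∂P := by
    refine integral_mono_ae (((integrable_const _).add hlog).const_mul _) hg ?_
    filter_upwards [hpos] with w hw
    have h1 := Real.add_one_le_exp (Real.log (g w) - c)
    rw [Real.exp_sub, Real.exp_log hw, le_div_iff₀ (Real.exp_pos c)] at h1
    linarith
  rw [integral_const_mul, integral_add (integrable_const _) hlog, ← hc] at h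
  simpa using h

variable {d : ℕ} {A : Fin d → Matrix (Fin n) (Fin n) ℂ}

lemma measurable_geomMean (A : Fin d → Matrix (Fin n) (Fin n) ℂ) : Measurable (geomMean A) :=
  (continuous_finsetProd _ fun i _ => continuous_quadForm (A i)).measurable.pow_const _

lemma geomMean_nonneg (hA : ∀ i, (A i).PosSemidef) (x : Vec n) : 0 ≤ geomMean A x :=
  Real.rpow_nonneg (Finset.prod_nonneg fun i _ => quadForm_nonneg (hA i) x) _

lemma exists_bound_geomMean (A : Fin d → Matrix (Fin n) (Fin n) ℂ) :
    ∃ C, ∀ x : Vec n, ‖x‖ = 1 → ‖geomMean A x‖ ≤ C := by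
  have hc : Continuous (geomMean A) :=
    (continuous_finsetProd _ fun i _ => continuous_quadForm (A i)).rpow_const
      fun x => Or.inr (by positivity)
  obtain ⟨C, hC⟩ := (isCompact_sphere (0 : Vec n) 1).exists_bound_of_continuousOn hc.continuousOn
  exact ⟨C, fun x hx => hC x (by simpa using hx)⟩

lemma quadForm_real_smul (B : Matrix (Fin n) (Fin n) ℂ) (c : ℝ) (x : Vec n) :
    quadForm B ((c : ℂ) • x) = c ^ 2 * quadForm B x := by
  simp only [quadForm, WithLp.ofLp_smul, Matrix.mulVec_smul, star_smul, smul_dotProduct,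
    dotProduct_smul, smul_eq_mul]
  simp [← mul_assoc, ← Complex.ofReal_mul, sq]

lemma log_geomMean_normalize (hd : 1 ≤ d) {x : Vec n} (hx : x ≠ 0)
    (hq : ∀ i, 0 < quadForm (A i) x) :
    0 < geomMean A (((‖x‖⁻¹ : ℝ) : ℂ) • x) ∧
    Real.log (geomMean A (((‖x‖⁻¹ : ℝ) : ℂ) • x))
      = (d : ℝ)⁻¹ * ∑ i, Real.log (quadForm (A i) x) - Real.log (‖x‖ ^ 2) := by
  have hd0 : (d : ℝ) ≠ 0 := by exact_mod_cast (by omega : d ≠ 0)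
  have hn : 0 < ‖x‖ := norm_pos_iff.2 hx
  have hpos : ∀ i, 0 < quadForm (A i) (((‖x‖⁻¹ : ℝ) : ℂ) • x) := by
    intro i
    rw [quadForm_real_smul]
    exact mul_pos (by positivity) (hq i)
  have hprod := Finset.prod_pos fun i (_ : i ∈ Finset.univ) => hpos i
  refine ⟨Real.rpow_pos_of_pos hprod _, ?_⟩
  rw [geomMean, Real.log_rpow hprod, Real.log_prod fun i _ => (hpos i).ne']
  have h : ∀ i, Real.log (quadForm (A i) (((‖x‖⁻¹ : ℝ) : ℂ) • x))
      = Real.log (quadForm (A i) x) - Real.log (‖x‖ ^ 2) := by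
    intro i
    rw [quadForm_real_smul, inv_pow, Real.log_mul (by positivity) (hq i).ne', Real.log_inv]
    ring
  simp only [h, Finset.sum_sub_distrib, Finset.sum_const, Finset.card_univ, Fintype.card_fin,
    nsmul_eq_mul]
  field_simp

/-- The rounding with a covariance `M` returns, in expectation, at least the geometric mean of the
values `tr (Aᵢ M) / tr M`, up to the loss `e^{-C}` when `M` has a large enough eigenvalue. -/
lemma exp_mul_le_integral_rounding (hd : 1 ≤ d) (hA : ∀ i, (A i).PosSemidef)
    {M : Matrix (Fin n) (Fin n) ℂ} (hM : M.PosSemidef) (hT : 0 < M.trace.re)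
    (hAM : ∀ i, 0 < (A i * M).trace.re) {k : ℕ} (hk : 1 ≤ k) {v : Vec n} (hv : ‖v‖ = 1)
    (hle : (k : ℝ) / (k + n - 1) * M.trace.re ≤ quadForm M v) {s : ℝ}
    (hs : d * s ≤ ∑ i, (Real.log (A i * M).trace.re - Real.log M.trace.re)) :
    Real.exp (s - Cconst n k)
      ≤ ∫ y, geomMean A y ∂((complexGaussian M).map fun x => ((‖x‖⁻¹ : ℝ) : ℂ) • x) := by
  have hd0 : (0 : ℝ) < d := by exact_mod_cast hd
  set R := CFC.sqrt M with hR
  have hRR : R * R = M := CFC.sqrt_mul_sqrt_self M (Matrix.nonneg_iff_posSemidef.2 hM)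
  have hRH : Rᴴ = R := (Matrix.nonneg_iff_posSemidef.1 (CFC.sqrt_nonneg M)).1
  have hmR : Measurable fun w : Fin n → ℂ => (WithLp.toLp 2 (R *ᵥ w) : Vec n) := by
    have : Continuous fun w : Fin n → ℂ => R *ᵥ w :=
      Continuous.matrix_mulVec continuous_const continuous_id
    exact ((PiLp.continuous_toLp 2 _).comp this).measurable
  have hmN : Measurable fun x : Vec n => ((‖x‖⁻¹ : ℝ) : ℂ) • x := by fun_prop
  rw [complexGaussian, Measure.map_map hmN hmR,
    integral_map (hmN.comp hmR).aemeasurable (measurable_geomMean A).aestronglyMeasurable]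
  have hH : ∀ i, (Rᴴ * A i * R).PosSemidef := fun i => (hA i).conjTranspose_mul_mul_same R
  have htr : ∀ i, (Rᴴ * A i * R).trace = (A i * M).trace := by
    intro i
    rw [hRH, Matrix.trace_mul_comm, ← mul_assoc, hRR, Matrix.trace_mul_comm]
  have hqM : ∀ w : Fin n → ℂ,
      ‖(WithLp.toLp 2 (R *ᵥ w) : Vec n)‖ ^ 2 = quadForm M (WithLp.toLp 2 w) := by
    intro w
    rw [← quadForm_one, quadForm_conj, Matrix.mul_one, hRH, hRR]
  have hHT : ∀ i, 0 < (Rᴴ * A i * R).trace.re := fun i => by rw [htr]; exact hAM i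
  have hae : ∀ᵐ w ∂(stdGaussianVec (Fin n)),
      0 < geomMean A (((‖(WithLp.toLp 2 (R *ᵥ w) : Vec n)‖⁻¹ : ℝ) : ℂ) • WithLp.toLp 2 (R *ᵥ w)) ∧
      Real.log (geomMean A
          (((‖(WithLp.toLp 2 (R *ᵥ w) : Vec n)‖⁻¹ : ℝ) : ℂ) • WithLp.toLp 2 (R *ᵥ w)))
        = (d : ℝ)⁻¹ * ∑ i, Real.log (quadForm (Rᴴ * A i * R) (WithLp.toLp 2 w))
          - Real.log (quadForm M (WithLp.toLp 2 w)) := by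
    filter_upwards [quadForm_pos_ae hM hT, ae_all_iff.2 fun i => quadForm_pos_ae (hH i) (hHT i)]
      with w hw hwi
    have hne : (WithLp.toLp 2 (R *ᵥ w) : Vec n) ≠ 0 := by
      intro h0
      rw [← hqM, h0] at hw
      simp at hw
    have h := log_geomMean_normalize (A := A) hd hne fun i => by
      rw [quadForm_conj]; exact hwi i
    simpa only [quadForm_conj, hqM] using h
  have hlogi : ∀ i, Integrable
      (fun w => Real.log (quadForm (Rᴴ * A i * R) (WithLp.toLp 2 w))) (stdGaussianVec (Fin n)) :=
    fun i => integrable_log_quadForm (hH i) (hHT i)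
  have hlogsum : Integrable (fun w => (d : ℝ)⁻¹ * ∑ i,
      Real.log (quadForm (Rᴴ * A i * R) (WithLp.toLp 2 w))) (stdGaussianVec (Fin n)) :=
    (integrable_finsetSum _ fun i _ => hlogi i).const_mul _
  have hlogM := integrable_log_quadForm hM hT
  have hlog : Integrable (fun w => Real.log (geomMean A
      (((‖(WithLp.toLp 2 (R *ᵥ w) : Vec n)‖⁻¹ : ℝ) : ℂ) • WithLp.toLp 2 (R *ᵥ w))))
      (stdGaussianVec (Fin n)) :=
    (hlogsum.sub hlogM).congr (hae.mono fun w hw => hw.2.symm)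
  have hint : Integrable (fun w => geomMean A
      (((‖(WithLp.toLp 2 (R *ᵥ w) : Vec n)‖⁻¹ : ℝ) : ℂ) • WithLp.toLp 2 (R *ᵥ w)))
      (stdGaussianVec (Fin n)) := by
    obtain ⟨C, hC⟩ := exists_bound_geomMean A
    refine Integrable.of_bound
      ((measurable_geomMean A).comp (hmN.comp hmR)).aestronglyMeasurable C ?_
    filter_upwards [quadForm_pos_ae hM hT] with w hw
    refine hC _ ?_
    have hne : ‖(WithLp.toLp 2 (R *ᵥ w) : Vec n)‖ ≠ 0 := by
      intro h0
      rw [← hqM, h0] at hw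
      simp at hw
    rw [norm_smul, Complex.norm_real, norm_inv, norm_norm, inv_mul_cancel₀ hne]
  have hJ := exp_integral_log_le (hae.mono fun w hw => hw.1) hint hlog
  refine le_trans (Real.exp_le_exp.2 ?_) hJ
  rw [integral_congr_ae (hae.mono fun w hw => hw.2), integral_sub hlogsum hlogM,
    integral_const_mul, integral_finsetSum _ fun i _ => hlogi i]
  have h1 := integral_log_quadForm_le hM hT hk hv hle
  have h2 : ∑ i, (Real.log (A i * M).trace.re - Real.eulerMascheroniConstant)
      ≤ ∑ i, ∫ w, Real.log (quadForm (Rᴴ * A i * R) (WithLp.toLp 2 w))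
          ∂(stdGaussianVec (Fin n)) := by
    refine Finset.sum_le_sum fun i _ => ?_
    rw [← htr]
    exact log_trace_sub_le_integral_log_quadForm (hH i) (hHT i)
  rw [Finset.sum_sub_distrib] at hs h2
  simp only [Finset.sum_const, Finset.card_univ, Fintype.card_fin, nsmul_eq_mul] at hs h2
  have h3 : s + Real.log M.trace.re - Real.eulerMascheroniConstant
      ≤ (d : ℝ)⁻¹ * ∑ i, ∫ w, Real.log (quadForm (Rᴴ * A i * R) (WithLp.toLp 2 w))
          ∂(stdGaussianVec (Fin n)) := by
    rw [le_inv_mul_iff₀ hd0]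
    linarith
  linarith

end

end PSDForms

theorem mainTheorem5 (n k : ℕ) (hn : 1 ≤ n) (hk : 1 ≤ k) :
    (∀ (d : ℕ) (A : Fin d → Matrix (Fin n) (Fin n) ℂ), k ≤ d → (∀ i, (A i).PosSemidef) →
      PSDForms.optSOS k A = PSDForms.opt A →
      ∀ L : PSDForms.RealPoly n →ₗ[ℝ] ℝ,
        PSDForms.IsOptimalPseudoExpectation k A L →
        PSDForms.IsExpectationOverSolutions k A L →
        ∃ v : PSDForms.Vec n, ‖v‖ = 1 ∧
          (PSDForms.momentMatrix k L v).PosSemidef ∧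
          PSDForms.momentMatrix k L v ≠ 0 ∧
          Real.exp (-PSDForms.Cconst n k) * PSDForms.optSOS k A ≤
            ∫ y, PSDForms.geomMean A y ∂(PSDForms.roundingLaw k L v)) ∧
    0 ≤ PSDForms.Cconst n k ∧
    PSDForms.Cconst n k ≤ PSDForms.Lconst n ∧
    AntitoneOn (PSDForms.Cconst n) (Set.Ici 1) ∧
    (2 ≤ n → StrictAntiOn (PSDForms.Cconst n) (Set.Ici 1)) := by
  refine ⟨?_, PSDForms.Cconst_nonneg hn hk, PSDForms.Cconst_le_Lconst hn hk,
    PSDForms.antitoneOn_Cconst hn, fun h => PSDForms.strictAntiOn_Cconst h⟩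
  intro d A hkd hA hSOS L _ ⟨μ, hprob, hμ, hL⟩
  have hsph : ∀ᵐ x ∂μ, ‖x‖ = 1 := hμ.mono fun x hx => hx.1
  obtain ⟨v, hv, hpos, hle⟩ := PSDForms.exists_direction hn hsph hk
  have hM := PSDForms.posSemidef_momentMatrix hk hL v
  have hquad : PSDForms.quadForm (PSDForms.momentMatrix k L v) v = PSDForms.dirMoment μ k v := by
    rw [PSDForms.quadForm_momentMatrix hk hL, PSDForms.dirMoment]
    simp only [← pow_succ, Nat.sub_add_cancel hk]
  have hdir : PSDForms.dirMoment μ (k - 1) v = (PSDForms.momentMatrix k L v).trace.re := by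
    have h := PSDForms.trace_mul_momentMatrix_eq_integral hk hL v 1
    rw [one_mul] at h
    rw [h, PSDForms.dirMoment]
    refine MeasureTheory.integral_congr_ae (hsph.mono fun x hx => ?_)
    simp [PSDForms.quadForm_one, hx]
  have hne : PSDForms.momentMatrix k L v ≠ 0 := by
    intro h0
    rw [h0] at hquad
    simp [PSDForms.quadForm] at hquad
    exact hpos.ne hquad
  refine ⟨v, hv, hM, hne, ?_⟩
  rw [hSOS]
  rcases le_or_gt (PSDForms.opt A) 0 with hopt | hopt
  · exact (mul_nonpos_of_nonneg_of_nonpos (Real.exp_pos _).le hopt).trans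
      (MeasureTheory.integral_nonneg fun y => PSDForms.geomMean_nonneg hA y)
  -- the trace is at least the largest eigenvalue, which is positive
  have hT : 0 < (PSDForms.momentMatrix k L v).trace.re := by
    obtain ⟨i, hi⟩ := PSDForms.exists_quadForm_le_eigenvalue hM.1 hv
    rw [PSDForms.trace_re_eq_sum_eigenvalues hM.1]
    exact Finset.sum_pos' (fun j _ => hM.eigenvalues_nonneg j)
      ⟨i, Finset.mem_univ i, (hquad ▸ hpos).trans_le hi⟩
  obtain ⟨h1, h2⟩ := PSDForms.mul_log_opt_le (hk.trans hkd) hA hsph (hμ.mono fun x hx => hx.2) hopt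
    (ρ := fun x => (‖inner ℂ v x‖ ^ 2) ^ (k - 1)) (by fun_prop) (fun x => by positivity)
    (hT.trans_eq hdir.symm)
  simp only [← PSDForms.trace_mul_momentMatrix_eq_integral hk hL] at h1 h2
  have h := PSDForms.exp_mul_le_integral_rounding (hk.trans hkd) hA hM hT h1 hk hv
    (by rwa [hquad, ← hdir]) (h2.trans_eq (by rw [← hdir]; rfl))
  rw [sub_eq_neg_add, Real.exp_add, Real.exp_log hopt] at h
  exact h
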